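/- **Setting.** Let $\Omega\subset\mathbb{R}^d$ be a bounded polyhedral domain with a conforming simplicial mesh, whose elements are distributed to $N$ subdomains $\Omega_1,\dots,\Omega_N$, let $\rho$ be integrable and uniformly positive on $\Omega$, and let $V_h$ be the continuous piecewise linear functions that vanish on $\partial\Omega$. Let $A^{(i)}$ be the stiffness matrix of $a_i(u,v)=\int_{\Omega_i}\rho\nabla u\cdot\nabla v$ on $V_h|_{\Omega_i}$ and $S^{(i)}$ its Schur complement on the interface unknowns of $\Omega_i$ (the nodes of $\Omega_i$ not on $\partial\Omega$ that are shared by at least two subdomains). The interface nodes are classified into vertices, faces and edges: apart from the vertices, they are divided into equivalence classes of nodes that are shared by the same set $I(G)$ of subdomains; a class $G$ is a face if $|I(G)|=2$ and an edge if $|I(G)|>2$. (The usual choice, in which the classes are the connected ones and single-node classes with $|I|>2$ are vertices, is included.) Let $\widetilde W$ be the space of interface unknowns that are strongly coupled at the vertices and decoupled elsewhere, $\widetilde R_i$ the restriction of $\widetilde W$ to the interface unknowns of $\Omega_i$, and $\widetilde S=\sum_i\widetilde R_i^TS^{(i)}\widetilde R_i$; assume that $\widetilde S$ is nonsingular. Let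 $B$ be the jump matrix with fully redundant multipliers: for every node of a face or edge $G$ and every pair $i<j$ in $I(G)$ it has a row $w^{(i)}-w^{(j)}$. Let $D_G^{(i)}$, $i\in I(G)$, be arbitrary square scaling matrices on the nodes of $G$ with $\sum_{i\in I(G)}D_G^{(i)}=I$, and let $B_D$ be obtained from $B$ by multiplying, in the block of subdomain $i$, the rows of the multipliers connecting $i$ and $j$ on $G$ by $(D_G^{(j)})^T$. Put $F_{DP}=B\widetilde S^{-1}B^T$ and $M_{FETI}^{-1}=B_D\widetilde SB_D^T$. For every face or edge $G$ let $S_G^{(i)}$ be the block of $S^{(i)}$ for the nodes of $G$, let $\widetilde S_G^{(i)}$ be the Schur complement of $S^{(i)}$ on the nodes of $G$, and consider $$A_Gv=\lambda\,\widetilde S_Gv,\qquad A_G=\sum_{m\in I(G)}\ \sum_{l\in I(G)\setminus\{m\}}(D_G^{(l)})^TS_G^{(m)}D_G^{(l)},$$ where $\widetilde S_G$ is the parallel sum of the $\widetilde S_G^{(i)}$, $i\in I(G)$ (for two matrices, $X:Y=Y(X+Y)^+X$), and $\lambda=\infty$ is allowed and means $\widetilde S_Gv=0$. Let $\lambda_{TOL}>0$.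 From a complete system of eigenvectors, orthonormal for $\langle A_G\,\cdot,\cdot\rangle$, choose those with $\lambda\ge\lambda_{TOL}$ if $G$ is a face and those with $\lambda>\lambda_{TOL}$ if $G$ is an edge. Let $U$ be the matrix with one column for every $G$, every chosen eigenvector $v$ on $G$ and every pair $i<j$ in $I(G)$: the column is $A_Gv$ on the multipliers that connect $i$ and $j$ on $G$, and zero elsewhere. Put $$P=U(U^TF_{DP}U)^{+}U^TF_{DP},\qquad M_{PP}^{-1}=P_B^T(I-P)M_{FETI}^{-1}(I-P)^TP_B,$$ where $^+$ is the pseudo inverse (the inverse if $U^TF_{DP}U$ is nonsingular) and $P_B$ is the orthogonal projection onto $\mathrm{Range}(B)$. **Theorem.** All eigenvalues of $M_{PP}^{-1}F_{DP}$ are real and nonnegative, and its condition number, the ratio of the largest to the smallest nonzero eigenvalue, satisfies $$\kappa(M_{PP}^{-1}F_{DP})\le C\lambda_{TOL},\qquad C=8\max\Big\{\max_iN_{F(i)}^2,\ \max_i\big(N_{E(i)}^2\max_{E\in E(i)}|I(E)|\big)\Big\},$$ where $N_{F(i)}$ is the number of faces of $\Omega_i$, $E(i)$ is the set of edges of $\Omega_i$,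 and $N_{E(i)}=|E(i)|$. (If there is no nonzero eigenvalue, $\kappa$ is taken to be $0$.) -/

import Mathlib

namespace FETIDP

open Matrix MeasureTheory
open scoped Classical ENNReal Gradient InnerProductSpace

noncomputable section

/-! ## Linear algebra -/

section LinearAlgebra

variable {m n k : Type*} [Fintype m] [Fintype n] [Fintype k]

/-- `X` is the (Moore-Penrose) pseudo inverse of `A`: the four Penrose equations. -/
structure IsPseudoInverse (A : Matrix m n ℝ) (X : Matrix n m ℝ) : Prop where
  mul_mul_self : A * X * A = A
  self_mul_mul : X * A * X = X
  left_symm : (A * X)ᵀ = A * X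
  right_symm : (X * A)ᵀ = X * A

theorem IsPseudoInverse.unique {A : Matrix m n ℝ} {X Y : Matrix n m ℝ}
    (hX : IsPseudoInverse A X) (hY : IsPseudoInverse A Y) : X = Y := by
  have h1 : A * X = A * Y := by
    have e : A * X = A * Y * (A * X) := by
      rw [← Matrix.mul_assoc, hY.mul_mul_self]
    have e2 : (A * X)ᵀ = (A * Y * (A * X))ᵀ := by rw [← e]
    rw [Matrix.transpose_mul (A * Y), hX.left_symm, hY.left_symm, ← Matrix.mul_assoc,
      hX.mul_mul_self] at e2
    exact e2
  have h2 : X * A = Y * A := by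
    have e : X * A = X * A * (Y * A) := by
      rw [Matrix.mul_assoc, ← Matrix.mul_assoc A, hY.mul_mul_self]
    have e2 : (X * A)ᵀ = (X * A * (Y * A))ᵀ := by rw [← e]
    rw [Matrix.transpose_mul (X * A), hX.right_symm, hY.right_symm, Matrix.mul_assoc,
      ← Matrix.mul_assoc A, hX.mul_mul_self] at e2
    exact e2
  rw [← hX.self_mul_mul, h2, Matrix.mul_assoc, h1, ← Matrix.mul_assoc, hY.self_mul_mul]

theorem exists_isPseudoInverse_of_symm (A : Matrix n n ℝ) (hA : Aᵀ = A) :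
    ∃ X, Xᵀ = X ∧ IsPseudoInverse A X := by
  have hH : A.IsHermitian := by
    rw [Matrix.IsHermitian, Matrix.conjTranspose_eq_transpose_of_trivial, hA]
  obtain ⟨Q, d, hQ, hd⟩ : ∃ (Q : Matrix n n ℝ) (d : n → ℝ), Qᵀ * Q = 1 ∧
      A = Q * diagonal d * Qᵀ := by
    refine ⟨hH.eigenvectorUnitary, hH.eigenvalues, ?_, ?_⟩
    · have := (Matrix.mem_unitaryGroup_iff').1 hH.eigenvectorUnitary.2
      simpa [Matrix.star_eq_conjTranspose] using this
    · have := hH.spectral_theorem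
      rw [Unitary.conjStarAlgAut_apply] at this
      simpa [Matrix.star_eq_conjTranspose, Function.comp_def] using this
  have key : ∀ a b : n → ℝ, (Q * diagonal a * Qᵀ) * (Q * diagonal b * Qᵀ)
      = Q * diagonal (fun i => a i * b i) * Qᵀ := by
    intro a b
    calc (Q * diagonal a * Qᵀ) * (Q * diagonal b * Qᵀ)
        = Q * diagonal a * (Qᵀ * Q) * diagonal b * Qᵀ := by simp only [Matrix.mul_assoc]
      _ = _ := by rw [hQ, Matrix.mul_one, Matrix.mul_assoc Q, diagonal_mul_diagonal]
  have tr : ∀ a : n → ℝ, (Q * diagonal a * Qᵀ)ᵀ = Q * diagonal a * Qᵀ := by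
    intro a
    simp [Matrix.transpose_mul, Matrix.mul_assoc]
  refine ⟨Q * diagonal (fun i => (d i)⁻¹) * Qᵀ, tr _, ?_, ?_, ?_, ?_⟩
  · rw [hd, key, key]
    congr 3; funext i
    by_cases h : d i = 0 <;> simp [h]
  · rw [hd, key, key]
    congr 3; funext i
    by_cases h : d i = 0 <;> simp [h]
  · rw [hd, key, tr]
  · rw [hd, key, tr]

theorem exists_isPseudoInverse (A : Matrix m n ℝ) : ∃ X, IsPseudoInverse A X := by
  obtain ⟨Y, hY, h⟩ := exists_isPseudoInverse_of_symm (Aᵀ * A)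
    (by rw [Matrix.transpose_mul, Matrix.transpose_transpose])
  have h3 := h.right_symm
  have hz : A - A * (Y * (Aᵀ * A)) = 0 := by
    rw [← Matrix.conjTranspose_mul_self_eq_zero, Matrix.conjTranspose_eq_transpose_of_trivial]
    have e : Aᵀ * (A - A * (Y * (Aᵀ * A))) = 0 := by
      rw [Matrix.mul_sub, ← Matrix.mul_assoc Aᵀ A, ← Matrix.mul_assoc (Aᵀ * A) Y, h.mul_mul_self,
        sub_self]
    rw [Matrix.transpose_sub, Matrix.transpose_mul A, h3, Matrix.sub_mul, Matrix.mul_assoc, e,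
      Matrix.mul_zero, sub_zero]
  have h1 : A * (Y * (Aᵀ * A)) = A := (sub_eq_zero.1 hz).symm
  refine ⟨Y * Aᵀ, ?_, ?_, ?_, ?_⟩
  · simpa only [Matrix.mul_assoc] using h1
  · have := congrArg (fun M => M * Aᵀ) h.self_mul_mul
    simpa only [Matrix.mul_assoc] using this
  · simp only [Matrix.transpose_mul, Matrix.transpose_transpose, hY, Matrix.mul_assoc]
  · rw [Matrix.mul_assoc, h3]

/-- The pseudo inverse `A⁺`. -/
def pinv (A : Matrix m n ℝ) : Matrix n m ℝ := (exists_isPseudoInverse A).choose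

theorem isPseudoInverse_pinv (A : Matrix m n ℝ) : IsPseudoInverse A (pinv A) :=
  (exists_isPseudoInverse A).choose_spec

theorem pinv_eq_inv (A : Matrix n n ℝ) (h : IsUnit A.det) : pinv A = A⁻¹ := by
  refine (isPseudoInverse_pinv A).unique ⟨?_, ?_, ?_, ?_⟩ <;>
    simp [Matrix.mul_nonsing_inv A h, Matrix.nonsing_inv_mul A h]

/-- Schur complement of `M` on the unknowns `f : k → m` (an injection), all other unknowns being
eliminated. (The eliminated block enters through its pseudo inverse, which is its inverse whenever
the block is nonsingular.) -/
def schur (M : Matrix m m ℝ) (f : k → m) : Matrix k k ℝ :=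
  let g : {x : m // x ∉ Set.range f} → m := Subtype.val
  M.submatrix f f - M.submatrix f g * pinv (M.submatrix g g) * M.submatrix g f

/-- Parallel sum `A : B = B (A + B)⁺ A`. -/
def parSum (A B : Matrix n n ℝ) : Matrix n n ℝ := B * pinv (A + B) * A

/-- Parallel sum `A₁ : A₂ : ⋯ : A_r`, bracketed from the left. -/
def parSumList : List (Matrix n n ℝ) → Matrix n n ℝ
  | [] => 0
  | A :: l => l.foldl parSum A

/-- `(lam, v)` is an eigenpair of `A v = lam S v`, where `lam = ∞` is allowed and means
`S v = 0`. -/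
def IsGenEigenpair (A S : Matrix n n ℝ) (lam : ℝ≥0∞) (v : n → ℝ) : Prop :=
  v ≠ 0 ∧ (lam ≠ ∞ → A *ᵥ v = lam.toReal • S *ᵥ v) ∧ (lam = ∞ → S *ᵥ v = 0)

/-- A complete system of eigenvectors of `A v = lam S v` (as many as there are unknowns),
orthonormal with respect to `⟨A ·, ·⟩`. -/
structure GenEigenSystem (A S : Matrix n n ℝ) where
  val : n → ℝ≥0∞
  vec : n → n → ℝ
  eigenpair : ∀ l, IsGenEigenpair A S (val l) (vec l)
  orthonormal : ∀ l l', (A *ᵥ vec l) ⬝ᵥ vec l' = if l = l' then 1 else 0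

/-- Orthogonal projection onto the column space of `M`, as a matrix. -/
def rangeProj (M : Matrix m n ℝ) : Matrix m m ℝ :=
  Matrix.toEuclideanLin.symm
    ((LinearMap.range (Matrix.toEuclideanLin M)).starProjection : _ →ₗ[ℝ] _)

/-- The spectrum in `ℂ` of a real matrix. -/
def cspec (M : Matrix m m ℝ) : Set ℂ := spectrum ℂ (M.map (fun x : ℝ => (x : ℂ)))

/-- Condition number of a (singular) preconditioned matrix: the largest modulus of a nonzero
eigenvalue divided by the smallest one. -/
def condNumber (M : Matrix m m ℝ) : ℝ :=
  sSup {r : ℝ | ∃ z ∈ cspec M, z ≠ 0 ∧ r = ‖z‖} / sInf {r : ℝ | ∃ z ∈ cspec M, z ≠ 0 ∧ r = ‖z‖}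

end LinearAlgebra

/-! ## Faces, edges and vertices of the interface

`ν` is the set of unknowns (nodes) and `own x` is the set of the subdomains that share `x`. A node is
on the interface if it is shared by at least two subdomains. -/

/-- A classification of the interface nodes: some of them are subdomain vertices, the remaining ones
are divided into equivalence classes, such that all nodes of a class are shared by the same
subdomains. -/
structure InterfaceClasses {N : ℕ} {ν : Type} (own : ν → Finset (Fin N)) where
  IsVertex : ν → Prop
  classes : Setoid {x : ν // 2 ≤ (own x).card ∧ ¬ IsVertex x}
  own_eq : ∀ {x y}, classes x y → own x.1 = own y.1

namespace InterfaceClasses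

variable {N : ℕ} {ν : Type} [Fintype ν] {own : ν → Finset (Fin N)} (cl : InterfaceClasses own)

/-- Interface nodes other than vertices. -/
abbrev Dual : Type := {x : ν // 2 ≤ (own x).card ∧ ¬ cl.IsVertex x}

/-- The vertices of the interface. -/
abbrev Primal : Type := {x : ν // 2 ≤ (own x).card ∧ cl.IsVertex x}

/-- The equivalence classes: faces and edges. -/
abbrev Class : Type := Quotient cl.classes

/-- The class of a node. -/
abbrev cls (x : cl.Dual) : cl.Class := Quotient.mk cl.classes x

/-- The nodes of a class ("the unknowns interior to" the face or edge). -/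
abbrev ClassNode (c : cl.Class) : Type := {x : cl.Dual // cl.cls x = c}

/-- `I(G)`: the set of the subdomains that share a face or edge `G`. -/
def I (c : cl.Class) : Finset (Fin N) :=
  Quotient.lift (fun x : cl.Dual => own x.1) (fun _ _ h => cl.own_eq h) c

/-- A class is a face if it is shared by two subdomains. -/
def IsFace (c : cl.Class) : Prop := (cl.I c).card = 2

/-- A class is an edge if it is shared by more than two subdomains. -/
def IsEdge (c : cl.Class) : Prop := 2 < (cl.I c).card

/-- `F(i)`: the faces of subdomain `i`. -/
def faces (i : Fin N) : Finset cl.Class := {c | i ∈ cl.I c ∧ cl.IsFace c}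

/-- `E(i)`: the edges of subdomain `i`. -/
def edges (i : Fin N) : Finset cl.Class := {c | i ∈ cl.I c ∧ cl.IsEdge c}

/-- `C = 8 max { max_i N_{F(i)}², max_i ( N_{E(i)}² max_{E ∈ E(i)} N_{I(E)} ) }`. -/
def boundConst : ℕ :=
  8 * max (Finset.univ.sup fun i => (cl.faces i).card ^ 2)
    (Finset.univ.sup fun i => (cl.edges i).card ^ 2 * (cl.edges i).sup fun c => (cl.I c).card)

/-- Unknowns of `W_Δ`: one copy of a dual node for every subdomain that shares it. -/
abbrev DualDof : Type := Σ x : cl.Dual, ↥(cl.I (cl.cls x))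

/-- Unknowns of the partially coupled space `W̃ = W_Δ × Ŵ_Π`. -/
abbrev TildeDof : Type := cl.DualDof ⊕ cl.Primal

/-- Fully redundant Lagrange multipliers: one for every dual node and every pair `i < j` of
subdomains that share it. -/
abbrev Multiplier : Type :=
  Σ x : cl.Dual, {p : ↥(cl.I (cl.cls x)) × ↥(cl.I (cl.cls x)) // p.1 < p.2}

/-- The jump operator `B`: the row `(x, i < j)` of `B w` is `w^{(i)}(x) - w^{(j)}(x)`. -/
def B : Matrix cl.Multiplier cl.TildeDof ℝ :=
  Matrix.of fun μ => Sum.elim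
    (fun y => if y.1 = μ.1 then
      (if (y.2 : Fin N) = μ.2.1.1 then 1 else if (y.2 : Fin N) = μ.2.1.2 then -1 else 0) else 0)
    (fun _ => 0)

/-- Scaling matrices `D_G^{(i)}`, one for every face or edge `G` and every `i ∈ I(G)`. -/
abbrev Scaling : Type := ∀ c : cl.Class, ↥(cl.I c) → Matrix (cl.ClassNode c) (cl.ClassNode c) ℝ

/-- Partition of unity: `∑_{i ∈ I(G)} D_G^{(i)} = I` for every face or edge `G`. -/
def IsPartitionOfUnity (D : cl.Scaling) : Prop := ∀ c, ∑ i, D c i = 1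

/-- The scaled jump operator `B_D`: in the block of subdomain `i`, the rows of `B` that belong to the
multipliers connecting `i` and `j` on `G` are multiplied by `(D_G^{(j)})ᵀ`. -/
def BD (D : cl.Scaling) : Matrix cl.Multiplier cl.TildeDof ℝ :=
  Matrix.of fun μ => Sum.elim
    (fun y => if h : cl.cls y.1 = cl.cls μ.1 then
      (if (y.2 : Fin N) = μ.2.1.1 then (D (cl.cls μ.1) μ.2.1.2)ᵀ ⟨μ.1, rfl⟩ ⟨y.1, h⟩
       else if (y.2 : Fin N) = μ.2.1.2 then - (D (cl.cls μ.1) μ.2.1.1)ᵀ ⟨μ.1, rfl⟩ ⟨y.1, h⟩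
       else 0) else 0)
    (fun _ => 0)

end InterfaceClasses

/-! ## Schur complements, generalized eigenvalue problems and preconditioners -/

section Algorithm

variable {N : ℕ} {ν : Type} [Fintype ν] {own : ν → Finset (Fin N)}

/-- Unknowns of `X_i`: the nodes of subdomain `i`. -/
abbrev XDof (own : ν → Finset (Fin N)) (i : Fin N) : Type := {x : ν // i ∈ own x}

/-- Unknowns of `W_i`: the interface nodes of subdomain `i`. -/
abbrev WDof (own : ν → Finset (Fin N)) (i : Fin N) : Type := {x : ν // i ∈ own x ∧ 2 ≤ (own x).card}

/-- Local stiffness matrices `A^{(i)}`. -/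
abbrev LocalMatrices (own : ν → Finset (Fin N)) : Type :=
  ∀ i : Fin N, Matrix (XDof own i) (XDof own i) ℝ

/-- `S^{(i)}`: Schur complement of `A^{(i)}` after eliminating the unknowns interior to subdomain
`i`. -/
def S (A : LocalMatrices own) (i : Fin N) : Matrix (WDof own i) (WDof own i) ℝ :=
  schur (A i) (fun x => ⟨x.1, x.2.1⟩)

variable (cl : InterfaceClasses own) (A : LocalMatrices own) (D : cl.Scaling)

/-- The restriction `R̃_i : W̃ → W_i`. -/
def Rtilde (i : Fin N) : Matrix (WDof own i) cl.TildeDof ℝ :=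
  Matrix.of fun x => Sum.elim
    (fun y => if (y.1 : ν) = x.1 ∧ (y.2 : Fin N) = i then 1 else 0)
    (fun v => if (v : ν) = x.1 then 1 else 0)

/-- The partially coupled matrix `S̃ = ∑ R̃_iᵀ S^{(i)} R̃_i`. -/
def Stilde : Matrix cl.TildeDof cl.TildeDof ℝ :=
  ∑ i, (Rtilde cl i)ᵀ * S A i * Rtilde cl i

/-- Inclusion of the nodes of a face or edge `G` into the unknowns of `W_i`, `i ∈ I(G)`. -/
def classIncl (c : cl.Class) (i : ↥(cl.I c)) (x : cl.ClassNode c) : WDof own i :=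
  ⟨x.1.1, by obtain ⟨x, rfl⟩ := x; exact i.2, x.1.2.1⟩

/-- `S_G^{(i)}`: block of `S^{(i)}` of the unknowns interior to `G`. -/
def Sblock (c : cl.Class) (i : ↥(cl.I c)) : Matrix (cl.ClassNode c) (cl.ClassNode c) ℝ :=
  (S A i).submatrix (classIncl cl c i) (classIncl cl c i)

/-- `S̃_G^{(i)}`: Schur complement of `S^{(i)}` after eliminating all unknowns except those interior
to `G`. -/
def Sschur (c : cl.Class) (i : ↥(cl.I c)) : Matrix (cl.ClassNode c) (cl.ClassNode c) ℝ :=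
  schur (S A i) (classIncl cl c i)

/-- Left-hand side `A_G = ∑_{m ∈ I(G)} ∑_{l ∈ I(G), l ≠ m} (D_G^{(l)})ᵀ S_G^{(m)} D_G^{(l)}` of the
generalized eigenvalue problem; for a face shared by `i` and `j` it is
`(D^{(j)})ᵀ S^{(i)} D^{(j)} + (D^{(i)})ᵀ S^{(j)} D^{(i)}`. -/
def eigLeft (c : cl.Class) : Matrix (cl.ClassNode c) (cl.ClassNode c) ℝ :=
  ∑ m : ↥(cl.I c), ∑ l ∈ Finset.univ.erase m, (D c l)ᵀ * Sblock cl A c m * D c l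

/-- Right-hand side of the generalized eigenvalue problem: the parallel sum of the matrices
`S̃_G^{(i)}`, `i ∈ I(G)`. -/
def eigRight (c : cl.Class) : Matrix (cl.ClassNode c) (cl.ClassNode c) ℝ :=
  parSumList (((Finset.univ : Finset ↥(cl.I c)).sort (· ≤ ·)).map (Sschur cl A c))

/-- A choice of eigenvectors for all faces and edges. -/
abbrev EigenChoice : Type := ∀ c : cl.Class, GenEigenSystem (eigLeft cl A D c) (eigRight cl A c)

variable {cl A D} (V : EigenChoice cl A D) (tol : ℝ)

/-- The eigenvectors that are chosen: eigenvalue `≥ tol` on faces, `> tol` on edges. -/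
def IsChosen (c : cl.Class) (l : cl.ClassNode c) : Prop :=
  if cl.IsFace c then ENNReal.ofReal tol ≤ (V c).val l else ENNReal.ofReal tol < (V c).val l

/-- Columns of `U`: a face or edge `G`, a pair of subdomains sharing it, a chosen eigenvector. -/
abbrev UIndex : Type :=
  Σ c : cl.Class, {p : ↥(cl.I c) × ↥(cl.I c) // p.1 < p.2} ×
    {l : cl.ClassNode c // IsChosen V tol c l}

/-- The matrix `U` of the adaptive constraints: the column `(G, i < j, l)` is `A_G v_l` on the
multipliers that connect `i` and `j` on `G`, and zero elsewhere, so that `Uᵀ B w = 0` says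
`⟨A_G v_l, w_G^{(i)} - w_G^{(j)}⟩ = 0` for all of these `(G, i < j, l)`. -/
def U : Matrix cl.Multiplier (UIndex V tol) ℝ :=
  Matrix.of fun μ u =>
    if h : cl.cls μ.1 = u.1 ∧ (μ.2.1.1 : Fin N) = u.2.1.1.1 ∧ (μ.2.1.2 : Fin N) = u.2.1.1.2 then
      (eigLeft cl A D u.1 *ᵥ (V u.1).vec u.2.2.1) ⟨μ.1, h.1⟩ else 0

variable (cl A D)

/-- The matrix `S̃` is nonsingular. -/
def StildeNonsingular : Prop := IsUnit (Stilde cl A)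

/-- `F_DP = B S̃⁻¹ Bᵀ`. -/
def FDP : Matrix cl.Multiplier cl.Multiplier ℝ := cl.B * (Stilde cl A)⁻¹ * cl.Bᵀ

/-- `M_FETI⁻¹ = B_D S̃ B_Dᵀ`. -/
def MFETIinv : Matrix cl.Multiplier cl.Multiplier ℝ := cl.BD D * Stilde cl A * (cl.BD D)ᵀ

variable {cl A D}

/-- `P = U (Uᵀ F_DP U)⁻¹ Uᵀ F_DP`. With fully redundant multipliers the matrix `Uᵀ F_DP U` can be
singular; the inverse is then the pseudo inverse. -/
def P : Matrix cl.Multiplier cl.Multiplier ℝ :=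
  U V tol * pinv ((U V tol)ᵀ * FDP cl A * U V tol) * (U V tol)ᵀ * FDP cl A

/-- The projector preconditioner `M_PP⁻¹ = P_Bᵀ (I - P) M_FETI⁻¹ (I - P)ᵀ P_B`, where `P_B` is the
orthogonal projection onto `Range(B)`. -/
def MPPinv : Matrix cl.Multiplier cl.Multiplier ℝ :=
  (rangeProj cl.B)ᵀ * (1 - P V tol) * MFETIinv cl A D * (1 - P V tol)ᵀ * rangeProj cl.B

/-- The preconditioned matrix `M_PP⁻¹ F_DP`. -/
def preconditioned : Matrix cl.Multiplier cl.Multiplier ℝ := MPPinv V tol * FDP cl A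

/-- The eigenvalues of `M_PP⁻¹ F_DP` in `ℂ`. -/
def eigenvalues : Set ℂ := cspec (preconditioned V tol)

/-- The condition number `κ(M_PP⁻¹ F_DP)`. -/
def kappa : ℝ := condNumber (preconditioned V tol)

end Algorithm

/-! ## The finite element discretization -/

/-- A conforming simplicial mesh of a bounded polyhedral domain in `ℝ^d`, whose cells are distributed
to `N` subdomains. -/
structure DecomposedMesh (d N : ℕ) where
  complex : Geometry.SimplicialComplex ℝ (EuclideanSpace ℝ (Fin d))
  finite : complex.faces.Finite
  pure : ∀ s ∈ complex.faces, ∃ t ∈ complex.faces, s ⊆ t ∧ t.card = d + 1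
  part : {t // t ∈ complex.faces ∧ t.card = d + 1} → Fin N

namespace DecomposedMesh

variable {d N : ℕ} (T : DecomposedMesh d N)

/-- The closed domain: the union of all simplices. -/
abbrev closedDomain : Set (EuclideanSpace ℝ (Fin d)) := T.complex.space

/-- The `d`-dimensional simplices. -/
abbrev Cell : Type := {t // t ∈ T.complex.faces ∧ t.card = d + 1}

/-- The nodes that are not on the boundary of the domain: the unknowns of `V_h`. -/
abbrev Node : Type :=
  {x : EuclideanSpace ℝ (Fin d) // x ∈ T.complex.vertices ∧ x ∈ interior T.closedDomain}

instance : Finite T.Cell :=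
  (T.finite.subset (fun _ h => h.1 : {t | t ∈ T.complex.faces ∧ t.card = d + 1} ⊆ _)).to_subtype

instance : Finite T.Node := by
  have h : {x : EuclideanSpace ℝ (Fin d) | {x} ∈ T.complex.faces}.Finite :=
    T.finite.preimage (fun _ _ _ _ h => Finset.singleton_injective h)
  exact (h.subset (fun _ hx => hx.1 :
    {x | x ∈ T.complex.vertices ∧ x ∈ interior T.closedDomain} ⊆ _)).to_subtype

instance : Fintype T.Cell := Fintype.ofFinite _

instance : Fintype T.Node := Fintype.ofFinite _

/-- The vertices of a cell, as an affine basis. -/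
def cellBasis (t : T.Cell) : AffineBasis t.1 ℝ (EuclideanSpace ℝ (Fin d)) :=
  ⟨(↑), T.complex.indep t.2.1,
    (T.complex.indep t.2.1).affineSpan_eq_top_iff_card_eq_finrank_add_one.2 (by simp [t.2.2])⟩

/-- The nodal values of the function of `V_h` with coefficient vector `u`: zero on the boundary. -/
def nodal (u : T.Node → ℝ) (x : EuclideanSpace ℝ (Fin d)) : ℝ :=
  if h : x ∈ T.complex.vertices ∧ x ∈ interior T.closedDomain then u ⟨x, h⟩ else 0

/-- The finite element function with coefficient vector `u` on the cell `t`: the affine function with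
the given values at the vertices of `t` (`coord` are the barycentric coordinates). -/
def onCell (t : T.Cell) (u : T.Node → ℝ) (p : EuclideanSpace ℝ (Fin d)) : ℝ :=
  ∑ x : t.1, T.nodal u x * (T.cellBasis t).coord x p

/-- `a_i(u, v) = ∫_{Ω_i} ρ ∇u · ∇v`, a sum over the cells of subdomain `i`. -/
def localForm (rho : EuclideanSpace ℝ (Fin d) → ℝ) (i : Fin N) (u v : T.Node → ℝ) : ℝ :=
  ∑ t : {t : T.Cell // T.part t = i}, ∫ p in convexHull ℝ (t.1.1 : Set (EuclideanSpace ℝ (Fin d))),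
    rho p * ⟪∇ (T.onCell t.1 u) p, ∇ (T.onCell t.1 v) p⟫_ℝ

/-- The subdomains that share a node. -/
def own (x : T.Node) : Finset (Fin N) := {i | ∃ t : T.Cell, T.part t = i ∧ x.1 ∈ t.1}

/-- The local stiffness matrices. -/
def stiffness (rho : EuclideanSpace ℝ (Fin d) → ℝ) : LocalMatrices T.own :=
  fun i => Matrix.of fun x y => T.localForm rho i (Pi.single x.1 1) (Pi.single y.1 1)

/-- Nodes that are shared by the same subdomains and are connected by a path of mesh edges through
such nodes. -/
def connected : Setoid T.Node :=
  Relation.EqvGen.setoid fun x y => T.own x = T.own y ∧ ∃ t : T.Cell, x.1 ∈ t.1 ∧ y.1 ∈ t.1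

/-- The usual classification of the interface nodes: the classes are the connected sets of nodes that
are shared by the same subdomains, and a class of a single node that is shared by more than two
subdomains is a vertex. -/
def standardClasses : InterfaceClasses T.own where
  IsVertex x := 2 < (T.own x).card ∧ ∀ y, T.connected x y → y = x
  classes := T.connected.comap Subtype.val
  own_eq {x y} h := by
    have key : ∀ a b : T.Node, T.connected a b → T.own a = T.own b := by
      intro a b hab
      induction hab with
      | rel _ _ h => exact h.1
      | refl => rfl
      | symm _ _ _ ih => exact ih.symm
      | trans _ _ _ _ _ ih1 ih2 => exact ih1.trans ih2
    exact key x.1 y.1 h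

end DecomposedMesh

end

end FETIDP

/-!
The proof works with the energies `xᵀ A x` of positive semidefinite matrices. Of the discretization
it uses only that the local stiffness matrices are positive semidefinite (`posSemidef_stiffness`:
they are sums of Gram matrices, since the gradients are constant on the cells); this passes to the
Schur complements `S^{(i)}` and `S̃_G^{(i)}`, to the parallel sums and to `S̃`.

*Algebraic part* (`cspec_projector`). Both `M_PP⁻¹` and `F = F_DP` are positive semidefinite, so
every eigenvalue of their product is real and nonnegative, and one that is not zero has a real
eigenvector `x` with `xᵀ F x > 0` (`cspec_mul_posSemidef`). Such an `x` satisfies `F P x = 0`. For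
`y = (I - P) x` and `q = S̃⁻¹ Bᵀ y` one has `Uᵀ B q = 0`, `|q|² = yᵀ F y = xᵀ F x` and, for the
eigenvalue `θ`, `θ |q|² = |B_Dᵀ B q|²`, where `|·|` is the energy norm of `S̃`. As `B B_Dᵀ B = B`
by the partition of unity, `|q|² = ⟨B_Dᵀ B q, q⟩ ≤ |B_Dᵀ B q| |q|`, whence `θ ≥ 1`. An upper bound
for `θ` is any `K` with `|B_Dᵀ B w|² ≤ K |w|²` whenever `Uᵀ B w = 0`.

*Local part* (`sum_energy_piece_le`). On a class `G` shared by `n` subdomains,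
`(B_Dᵀ B w)^{(i)} = ∑_{l ≠ i} D^{(l)} (w^{(i)} - w^{(l)})`, and the differences do not change if the
mean over all subdomains is subtracted, which leaves `u^{(i)}`. By the Cauchy-Schwarz inequality and
the definition of `A_G`, the energies of these sums add up to at most `2 (n - 1) ∑ |u^{(i)}|²_{A_G}`.
The constraints say that the `u^{(i)}` are `A_G`-orthogonal to all eigenvectors with `λ > tol`, so
`|u^{(i)}|²_{A_G} ≤ tol |u^{(i)}|²` in the energy of the parallel sum
(`GenEigenSystem.energy_le`). Subtracting the mean has not increased the sum of these energies
(`sum_energy_sub_mean_le`), and the parallel sum is bounded by each `S̃_G^{(i)}`, hence the bound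
`2 (n - 1) tol ∑ |w^{(i)}|²_{S^{(i)}}`.

*Summation* (`energy_BD_transpose_B_le`). In each subdomain the face part and the edge part are
separated and the Cauchy-Schwarz inequality is applied to each, which brings in the numbers of faces
and of edges of the subdomains sharing a class; `sum_card_mul_sum_le` does the counting.
-/

namespace FETIDP

open Matrix MeasureTheory
open scoped Classical ENNReal Gradient InnerProductSpace

noncomputable section

/-! ### Energies of positive semidefinite matrices -/

section Energy

variable {m n k : Type*} [Fintype m] [Fintype n] [Fintype k]

/-- The energy `xᵀ A x` of the vector `x` with respect to the matrix `A`. -/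
def energy (A : Matrix n n ℝ) (x : n → ℝ) : ℝ := x ⬝ᵥ A *ᵥ x

theorem energy_nonneg {A : Matrix n n ℝ} (hA : A.PosSemidef) (x : n → ℝ) : 0 ≤ energy A x := by
  simpa [energy] using hA.dotProduct_mulVec_nonneg x

omit [Fintype n] in
theorem transpose_eq_of_posSemidef {A : Matrix n n ℝ} (hA : A.PosSemidef) : Aᵀ = A := by
  simpa [Matrix.IsHermitian, conjTranspose_eq_transpose_of_trivial] using hA.isHermitian

theorem posSemidef_of_energy {A : Matrix n n ℝ} (hA : Aᵀ = A) (h : ∀ x, 0 ≤ energy A x) :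
    A.PosSemidef := by
  refine .of_dotProduct_mulVec_nonneg ?_ fun x => by simpa [energy] using h x
  rw [Matrix.IsHermitian, conjTranspose_eq_transpose_of_trivial, hA]

theorem posSemidef_transpose_mul_self (C : Matrix m n ℝ) : (Cᵀ * C).PosSemidef := by
  simpa [conjTranspose_eq_transpose_of_trivial] using posSemidef_conjTranspose_mul_self C

open scoped MatrixOrder in
theorem exists_gram {A : Matrix n n ℝ} (hA : A.PosSemidef) : ∃ C : Matrix n n ℝ, A = Cᵀ * C := by
  obtain ⟨C, hC⟩ := CStarAlgebra.nonneg_iff_eq_star_mul_self.mp hA.nonneg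
  exact ⟨C, by simpa [star_eq_conjTranspose, conjTranspose_eq_transpose_of_trivial] using hC⟩

theorem dotProduct_mulVec_comm {A : Matrix n n ℝ} (hA : Aᵀ = A) (x y : n → ℝ) :
    x ⬝ᵥ A *ᵥ y = y ⬝ᵥ A *ᵥ x := by
  rw [dotProduct_mulVec, ← mulVec_transpose, hA, dotProduct_comm]

theorem dotProduct_transpose_mulVec (C : Matrix m n ℝ) (x : n → ℝ) (y : m → ℝ) :
    x ⬝ᵥ Cᵀ *ᵥ y = (C *ᵥ x) ⬝ᵥ y := by
  rw [dotProduct_mulVec, vecMul_transpose]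

theorem energy_conj (C : Matrix m n ℝ) (A : Matrix m m ℝ) (x : n → ℝ) :
    energy (Cᵀ * A * C) x = energy A (C *ᵥ x) := by
  rw [energy, energy, ← mulVec_mulVec, ← mulVec_mulVec, dotProduct_transpose_mulVec]

theorem energy_gram (C : Matrix m n ℝ) (x : n → ℝ) :
    energy (Cᵀ * C) x = (C *ᵥ x) ⬝ᵥ (C *ᵥ x) := by
  rw [energy, ← mulVec_mulVec, dotProduct_transpose_mulVec]

theorem energy_add_left (A B : Matrix n n ℝ) (x : n → ℝ) :
    energy (A + B) x = energy A x + energy B x := by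
  simp [energy, add_mulVec]

theorem energy_sub_left (A B : Matrix n n ℝ) (x : n → ℝ) :
    energy (A - B) x = energy A x - energy B x := by
  simp [energy, sub_mulVec]

theorem energy_sum_left {ι : Type*} (s : Finset ι) (A : ι → Matrix n n ℝ) (x : n → ℝ) :
    energy (∑ i ∈ s, A i) x = ∑ i ∈ s, energy (A i) x := by
  simp [energy, sum_mulVec, dotProduct_sum]

theorem energy_neg (A : Matrix n n ℝ) (x : n → ℝ) : energy A (-x) = energy A x := by
  simp [energy, mulVec_neg]

/-- The Cauchy-Schwarz inequality for sums of vectors. -/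
theorem energy_sum_le {A : Matrix n n ℝ} (hA : A.PosSemidef) {ι : Type*} (s : Finset ι)
    (f : ι → n → ℝ) :
    energy A (∑ i ∈ s, f i) ≤ s.card * ∑ i ∈ s, energy A (f i) := by
  obtain ⟨C, rfl⟩ := exists_gram hA
  simp only [energy_gram, mulVec_sum, dotProduct]
  rw [Finset.sum_comm, Finset.mul_sum]
  refine Finset.sum_le_sum fun j _ => ?_
  simp only [Finset.sum_apply, ← pow_two]
  exact sq_sum_le_card_mul_sum_sq

theorem energy_add_le {A : Matrix n n ℝ} (hA : A.PosSemidef) (x y : n → ℝ) :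
    energy A (x + y) ≤ 2 * (energy A x + energy A y) := by
  simpa [Fin.sum_univ_two] using energy_sum_le hA Finset.univ ![x, y]

theorem energy_sub_le {A : Matrix n n ℝ} (hA : A.PosSemidef) (x y : n → ℝ) :
    energy A (x - y) ≤ 2 * (energy A x + energy A y) := by
  simpa [sub_eq_add_neg, energy_neg] using energy_add_le hA x (-y)

theorem dotProduct_sq_le_energy {A : Matrix n n ℝ} (hA : A.PosSemidef) (x y : n → ℝ) :
    (x ⬝ᵥ A *ᵥ y) ^ 2 ≤ energy A x * energy A y := by
  obtain ⟨C, rfl⟩ := exists_gram hA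
  rw [energy_gram, energy_gram, ← mulVec_mulVec, dotProduct_transpose_mulVec]
  simpa only [dotProduct, ← pow_two] using
    Finset.sum_mul_sq_le_sq_mul_sq Finset.univ (C *ᵥ x) (C *ᵥ y)

theorem mulVec_eq_zero_of_energy {A : Matrix n n ℝ} (hA : A.PosSemidef) {x : n → ℝ}
    (hx : energy A x = 0) : A *ᵥ x = 0 := by
  obtain ⟨C, rfl⟩ := exists_gram hA
  rw [energy_gram, dotProduct_self_eq_zero] at hx
  rw [← mulVec_mulVec, hx, mulVec_zero]

/-- Subtracting the mean from a family of vectors does not increase the sum of the energies. -/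
theorem sum_energy_sub_mean_le {A : Matrix n n ℝ} (hA : A.PosSemidef) {ι : Type*} [Fintype ι]
    (w : ι → n → ℝ) :
    ∑ i, energy A (w i - (Fintype.card ι : ℝ)⁻¹ • ∑ j, w j) ≤ ∑ i, energy A (w i) := by
  rcases isEmpty_or_nonempty ι with h | h
  · simp
  set c : n → ℝ := (Fintype.card ι : ℝ)⁻¹ • ∑ j, w j with hc
  have hsum : ∑ i, w i = (Fintype.card ι : ℝ) • c := by
    rw [hc, smul_smul, mul_inv_cancel₀ (by positivity), one_smul]
  have e : ∀ i, energy A (w i - c) = energy A (w i) - 2 * (c ⬝ᵥ A *ᵥ w i) + energy A c := by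
    intro i
    simp only [energy, mulVec_sub, dotProduct_sub, sub_dotProduct,
      dotProduct_mulVec_comm (transpose_eq_of_posSemidef hA) (w i) c]
    ring
  have e2 : ∑ i, c ⬝ᵥ A *ᵥ w i = Fintype.card ι * energy A c := by
    rw [← dotProduct_sum, ← mulVec_sum, hsum, mulVec_smul, dotProduct_smul, energy, smul_eq_mul]
  simp only [e, Finset.sum_add_distrib, Finset.sum_sub_distrib, ← Finset.mul_sum, e2,
    Finset.sum_const, Finset.card_univ, nsmul_eq_mul]
  have := mul_nonneg (Nat.cast_nonneg (α := ℝ) (Fintype.card ι)) (energy_nonneg hA c)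
  linarith

end Energy

/-! ### Pseudo inverses, Schur complements and parallel sums -/

section Pinv

variable {m n k : Type*} [Fintype m] [Fintype n] [Fintype k]

theorem pinv_transpose_of_symm {A : Matrix n n ℝ} (hA : Aᵀ = A) : (pinv A)ᵀ = pinv A := by
  obtain ⟨X, hX, h⟩ := exists_isPseudoInverse_of_symm A hA
  rw [(isPseudoInverse_pinv A).unique h, hX]

theorem posSemidef_pinv {A : Matrix n n ℝ} (hA : A.PosSemidef) : (pinv A).PosSemidef := by
  have ht := pinv_transpose_of_symm (transpose_eq_of_posSemidef hA)
  refine posSemidef_of_energy ht fun x => ?_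
  have := energy_conj (pinv A) A x
  rw [ht, (isPseudoInverse_pinv A).self_mul_mul] at this
  rw [this]
  exact energy_nonneg hA _

/-- The pseudo inverse of a Gram matrix `Cᵀ C` inverts it on the row space of `C`. -/
theorem gram_mul_pinv_mul_transpose (C : Matrix m n ℝ) :
    Cᵀ * C * pinv (Cᵀ * C) * Cᵀ = Cᵀ := by
  have hs : (Cᵀ * C)ᵀ = Cᵀ * C := by rw [transpose_mul, transpose_transpose]
  have h := isPseudoInverse_pinv (Cᵀ * C)
  set X := pinv (Cᵀ * C)
  have hX : Xᵀ = X := pinv_transpose_of_symm hs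
  have hz : C - C * (X * (Cᵀ * C)) = 0 := by
    rw [← conjTranspose_mul_self_eq_zero, conjTranspose_eq_transpose_of_trivial]
    have e : Cᵀ * (C - C * (X * (Cᵀ * C))) = 0 := by
      rw [Matrix.mul_sub, ← Matrix.mul_assoc Cᵀ C, ← Matrix.mul_assoc (Cᵀ * C) X, h.mul_mul_self,
        sub_self]
    rw [transpose_sub, transpose_mul C, h.right_symm, Matrix.sub_mul, Matrix.mul_assoc, e,
      Matrix.mul_zero, sub_zero]
  have h1 := congrArg transpose (sub_eq_zero.1 hz)
  rw [transpose_mul, transpose_mul, hs, hX] at h1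
  exact h1.symm

/-- With `M = Cᵀ C`, the Schur complement is the Gram matrix of the columns of `C` that are kept,
projected orthogonally to the columns that are eliminated. -/
theorem schur_gram (C : Matrix n m ℝ) (f : k → m) :
    ∃ Q : Matrix n n ℝ, Qᵀ = Q ∧ Q * Q = Q ∧
      (∀ g : {x : m // x ∉ Set.range f} → m, g = Subtype.val → Q * C.submatrix id g = 0) ∧
      schur (Cᵀ * C) f = (Q * C.submatrix id f)ᵀ * (Q * C.submatrix id f) := by
  set g : {x : m // x ∉ Set.range f} → m := Subtype.val with hg
  set F := C.submatrix id f with hF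
  set G := C.submatrix id g with hG
  set X := pinv (Gᵀ * G) with hX
  have hXt : Xᵀ = X :=
    pinv_transpose_of_symm (by rw [transpose_mul, transpose_transpose])
  have hGX : Gᵀ * G * X * Gᵀ = Gᵀ := gram_mul_pinv_mul_transpose G
  have hQt : (1 - G * X * Gᵀ)ᵀ = 1 - G * X * Gᵀ := by
    simp [transpose_sub, transpose_mul, hXt, Matrix.mul_assoc]
  have hGQ : Gᵀ * (1 - G * X * Gᵀ) = 0 := by
    rw [Matrix.mul_sub, Matrix.mul_one, ← Matrix.mul_assoc, ← Matrix.mul_assoc, hGX, sub_self]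
  have hQQ : (1 - G * X * Gᵀ) * (1 - G * X * Gᵀ) = 1 - G * X * Gᵀ := by
    rw [Matrix.sub_mul (1 : Matrix n n ℝ), Matrix.one_mul, Matrix.mul_assoc (G * X), hGQ,
      Matrix.mul_zero, sub_zero]
  refine ⟨1 - G * X * Gᵀ, hQt, hQQ, ?_, ?_⟩
  · rintro g' rfl
    have := congrArg transpose hGQ
    rwa [transpose_mul, hQt, transpose_transpose, transpose_zero] at this
  · have e1 : (Cᵀ * C).submatrix f f = Fᵀ * F := by ext i j; rfl
    have e2 : (Cᵀ * C).submatrix f g = Fᵀ * G := by ext i j; rfl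
    have e3 : (Cᵀ * C).submatrix g g = Gᵀ * G := by ext i j; rfl
    have e4 : (Cᵀ * C).submatrix g f = Gᵀ * F := by ext i j; rfl
    rw [schur]
    simp only [← hg, e1, e2, e3, e4, ← hX]
    have e5 : ∀ Q : Matrix n n ℝ, (Q * F)ᵀ * (Q * F) = Fᵀ * (Qᵀ * Q) * F := by
      intro Q
      rw [transpose_mul]; simp only [Matrix.mul_assoc]
    rw [e5, hQt, hQQ, Matrix.mul_sub, Matrix.mul_one, Matrix.sub_mul]
    simp only [Matrix.mul_assoc]

theorem posSemidef_schur {M : Matrix m m ℝ} (hM : M.PosSemidef) (f : k → m) :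
    (schur M f).PosSemidef := by
  obtain ⟨C, rfl⟩ := exists_gram hM
  obtain ⟨Q, -, -, -, h⟩ := schur_gram C f
  rw [h]
  exact posSemidef_transpose_mul_self _

/-- The energy of a Schur complement is at most the energy of any extension. -/
theorem energy_schur_le {M : Matrix m m ℝ} (hM : M.PosSemidef) {f : k → m}
    (hf : Function.Injective f) (z : m → ℝ) : energy (schur M f) (z ∘ f) ≤ energy M z := by
  obtain ⟨C, rfl⟩ := exists_gram hM
  obtain ⟨Q, hQt, hQQ, hQ, h⟩ := schur_gram C f
  have hz : C *ᵥ z = C.submatrix id f *ᵥ (z ∘ f)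
      + C.submatrix id (Subtype.val : {x : m // x ∉ Set.range f} → m) *ᵥ (z ∘ Subtype.val) := by
    funext i
    simp only [mulVec, dotProduct, Pi.add_apply, submatrix_apply, id, Function.comp]
    rw [← Finset.sum_add_sum_compl (Finset.univ.image f), Finset.sum_image (fun _ _ _ _ h => hf h)]
    congr 1
    exact Finset.sum_subtype _ (fun x => by simp) _
  have e : (Q * C.submatrix id f) *ᵥ (z ∘ f) = Q *ᵥ (C *ᵥ z) := by
    rw [hz, mulVec_add, mulVec_mulVec, mulVec_mulVec, hQ _ rfl, zero_mulVec, add_zero]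
  rw [h, energy_gram, energy_gram, e]
  generalize C *ᵥ z = v
  have h1 : (Q *ᵥ v) ⬝ᵥ (Q *ᵥ v) = v ⬝ᵥ Q *ᵥ v := by
    rw [← dotProduct_transpose_mulVec, hQt, mulVec_mulVec, hQQ]
  have h2 : 0 ≤ (v - Q *ᵥ v) ⬝ᵥ (v - Q *ᵥ v) := by
    simpa using dotProduct_star_self_nonneg (v - Q *ᵥ v)
  simp only [sub_dotProduct, dotProduct_sub, h1, dotProduct_comm (Q *ᵥ v) v] at h2
  rw [h1]
  linarith

theorem add_mul_pinv_mul_left {A B : Matrix n n ℝ} (hA : A.PosSemidef) (hB : B.PosSemidef) :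
    (A + B) * pinv (A + B) * A = A := by
  obtain ⟨a, rfl⟩ := exists_gram hA
  obtain ⟨b, rfl⟩ := exists_gram hB
  have h := gram_mul_pinv_mul_transpose (fromRows a b)
  rw [transpose_fromRows, fromCols_mul_fromRows] at h
  have := congrArg (· * fromRows a (0 : Matrix n n ℝ)) h
  simpa only [Matrix.mul_assoc, fromCols_mul_fromRows, Matrix.mul_zero, add_zero] using this

theorem parSum_eq_left {A B : Matrix n n ℝ} (hA : A.PosSemidef) (hB : B.PosSemidef) :
    parSum A B = A - A * pinv (A + B) * A := by
  conv_rhs => enter [1]; rw [← add_mul_pinv_mul_left hA hB]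
  rw [parSum, Matrix.add_mul, Matrix.add_mul, add_sub_cancel_left]

theorem parSum_eq_right {A B : Matrix n n ℝ} (hA : A.PosSemidef) (hB : B.PosSemidef) :
    parSum A B = B - B * pinv (A + B) * B := by
  have h := congrArg transpose (add_mul_pinv_mul_left hB hA)
  rw [add_comm B A, transpose_mul, transpose_mul, transpose_eq_of_posSemidef hB,
    transpose_eq_of_posSemidef (hA.add hB),
    pinv_transpose_of_symm (transpose_eq_of_posSemidef (hA.add hB)),
    ← Matrix.mul_assoc] at h
  conv_rhs => enter [1]; rw [← h]
  rw [parSum, Matrix.mul_add, add_sub_cancel_right]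

theorem posSemidef_parSum {A B : Matrix n n ℝ} (hA : A.PosSemidef) (hB : B.PosSemidef) :
    (parSum A B).PosSemidef := by
  have hX := pinv_transpose_of_symm (transpose_eq_of_posSemidef (hA.add hB))
  have hXC := (isPseudoInverse_pinv (A + B)).self_mul_mul
  rw [parSum_eq_left hA hB]
  set X := pinv (A + B)
  refine posSemidef_of_energy (by
    simp [transpose_sub, transpose_mul, transpose_eq_of_posSemidef hA, hX,
      Matrix.mul_assoc]) fun x => ?_
  -- With `y = (A + B)⁺ A x`, the energy is that of `x - y` for `A` plus that of `y` for `B`.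
  have e1 : energy (A * X * A) x = energy X (A *ᵥ x) := by
    have := energy_conj A X x
    rwa [transpose_eq_of_posSemidef hA] at this
  have e2 : energy (A + B) (X *ᵥ A *ᵥ x) = energy X (A *ᵥ x) := by
    rw [← energy_conj, hX, hXC]
  have e3 : x ⬝ᵥ A *ᵥ (X *ᵥ A *ᵥ x) = energy X (A *ᵥ x) := by
    rw [dotProduct_mulVec_comm (transpose_eq_of_posSemidef hA), dotProduct_comm, energy]
  have e4 : energy A (x - X *ᵥ A *ᵥ x)
      = energy A x - 2 * energy X (A *ᵥ x) + energy A (X *ᵥ A *ᵥ x) := by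
    rw [← e3]
    simp only [energy, mulVec_sub, dotProduct_sub, sub_dotProduct,
      dotProduct_mulVec_comm (transpose_eq_of_posSemidef hA) (X *ᵥ A *ᵥ x) x]
    ring
  have h1 := energy_nonneg hA (x - X *ᵥ A *ᵥ x)
  have h2 := energy_nonneg hB (X *ᵥ A *ᵥ x)
  rw [energy_add_left] at e2
  rw [energy_sub_left, e1]
  linarith

theorem energy_parSum_le_left {A B : Matrix n n ℝ} (hA : A.PosSemidef) (hB : B.PosSemidef)
    (x : n → ℝ) : energy (parSum A B) x ≤ energy A x := by
  have := energy_conj A (pinv (A + B)) x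
  rw [transpose_eq_of_posSemidef hA] at this
  rw [parSum_eq_left hA hB, energy_sub_left, this]
  linarith [energy_nonneg (posSemidef_pinv (hA.add hB)) (A *ᵥ x)]

theorem energy_parSum_le_right {A B : Matrix n n ℝ} (hA : A.PosSemidef) (hB : B.PosSemidef)
    (x : n → ℝ) : energy (parSum A B) x ≤ energy B x := by
  have := energy_conj B (pinv (A + B)) x
  rw [transpose_eq_of_posSemidef hB] at this
  rw [parSum_eq_right hA hB, energy_sub_left, this]
  linarith [energy_nonneg (posSemidef_pinv (hA.add hB)) (B *ᵥ x)]

theorem foldl_parSum {l : List (Matrix n n ℝ)} {A : Matrix n n ℝ} (hA : A.PosSemidef)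
    (hl : ∀ B ∈ l, B.PosSemidef) :
    (l.foldl parSum A).PosSemidef ∧ (∀ x, energy (l.foldl parSum A) x ≤ energy A x) ∧
      ∀ B ∈ l, ∀ x, energy (l.foldl parSum A) x ≤ energy B x := by
  induction l generalizing A with
  | nil => simp [hA]
  | cons B l ih =>
    have hB := hl B (by simp)
    obtain ⟨h1, h2, h3⟩ := ih (posSemidef_parSum hA hB) fun B' h => hl B' (by simp [h])
    refine ⟨h1, fun x => (h2 x).trans (energy_parSum_le_left hA hB x), ?_⟩
    intro B' hB' x
    rcases List.mem_cons.1 hB' with rfl | h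
    · exact (h2 x).trans (energy_parSum_le_right hA hB x)
    · exact h3 B' h x

theorem posSemidef_parSumList {l : List (Matrix n n ℝ)} (hl : ∀ B ∈ l, B.PosSemidef) :
    (parSumList l).PosSemidef := by
  cases l with
  | nil => exact .zero
  | cons A l => exact (foldl_parSum (hl A (by simp)) fun B h => hl B (List.mem_cons_of_mem _ h)).1

/-- A parallel sum is bounded by each of its terms. -/
theorem energy_parSumList_le {l : List (Matrix n n ℝ)} (hl : ∀ B ∈ l, B.PosSemidef)
    {B : Matrix n n ℝ} (hB : B ∈ l) (x : n → ℝ) : energy (parSumList l) x ≤ energy B x := by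
  cases l with
  | nil => simp at hB
  | cons A l =>
    obtain ⟨-, h2, h3⟩ := foldl_parSum (hl A (by simp)) fun B h => hl B (List.mem_cons_of_mem _ h)
    rcases List.mem_cons.1 hB with rfl | h
    · exact h2 x
    · exact h3 B h x

end Pinv

/-! ### Generalized eigenvalue problems -/

section GenEigen

variable {n : Type*} [Fintype n]

/-- If a vector is `A`-orthogonal to all eigenvectors of `A v = λ S v` with `λ > tol`, then its
`A`-energy is at most `tol` times its `S`-energy. -/
theorem GenEigenSystem.energy_le {A S : Matrix n n ℝ} (V : GenEigenSystem A S) {tol : ℝ}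
    (htol : 0 < tol) {z : n → ℝ}
    (hz : ∀ l, ENNReal.ofReal tol < V.val l → (A *ᵥ V.vec l) ⬝ᵥ z = 0) (hA : Aᵀ = A) :
    energy A z ≤ tol * energy S z := by
  set E : Matrix n n ℝ := Matrix.of V.vec
  have h1 : E * A * Eᵀ = 1 := by
    ext l l'
    rw [Matrix.mul_assoc, Matrix.one_apply, ← V.orthonormal l l', dotProduct_comm,
      dotProduct_mulVec_comm hA]
    rfl
  have h2 : Eᵀ * (E * A) = 1 := mul_eq_one_comm.1 h1
  set c : n → ℝ := (E * A) *ᵥ z with hc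
  have hzc : z = Eᵀ *ᵥ c := by rw [hc, mulVec_mulVec, h2, one_mulVec]
  have hcl : ∀ l, c l = (A *ᵥ V.vec l) ⬝ᵥ z := by
    intro l
    rw [hc, ← mulVec_mulVec, dotProduct_comm, dotProduct_mulVec_comm hA]
    rfl
  -- `λ = 0` is impossible, and `λ = ∞` corresponds to `λ⁻¹ = 0`.
  have hpos : ∀ l, V.val l ≠ 0 := by
    intro l h0
    have h := (V.eigenpair l).2.1 (by simp [h0])
    have := V.orthonormal l l
    simp [h, h0] at this
  have hSv : ∀ l, S *ᵥ V.vec l = (V.val l).toReal⁻¹ • A *ᵥ V.vec l := by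
    intro l
    by_cases htop : V.val l = ∞
    · simp [htop, (V.eigenpair l).2.2 htop]
    · rw [(V.eigenpair l).2.1 htop, smul_smul,
        inv_mul_cancel₀ (ENNReal.toReal_ne_zero.2 ⟨hpos l, htop⟩), one_smul]
  have hS : S * Eᵀ = A * Eᵀ * diagonal fun l => (V.val l).toReal⁻¹ := by
    ext i l
    rw [mul_diagonal, mul_comm]
    exact congrFun (hSv l) i
  have hEt : z ⬝ᵥ A *ᵥ z = ∑ l, c l * c l := by
    have := energy_conj Eᵀ A c
    rw [transpose_transpose, h1, ← hzc] at this
    rw [← energy, ← this, energy, one_mulVec]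
    rfl
  have hSt : energy S z = ∑ l, (V.val l).toReal⁻¹ * (c l * c l) := by
    have := energy_conj Eᵀ S c
    rw [transpose_transpose, Matrix.mul_assoc, hS, ← Matrix.mul_assoc, ← Matrix.mul_assoc, h1,
      Matrix.one_mul, ← hzc] at this
    rw [← this, energy]
    simp only [dotProduct, mulVec_diagonal]
    exact Finset.sum_congr rfl fun l _ => by ring
  rw [energy, hEt, hSt, Finset.mul_sum]
  refine Finset.sum_le_sum fun l _ => ?_
  by_cases hl : ENNReal.ofReal tol < V.val l
  · simp [hcl l, hz l hl]
  · have hle : V.val l ≤ ENNReal.ofReal tol := not_lt.1 hl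
    have htop : V.val l ≠ ∞ := ne_top_of_le_ne_top ENNReal.ofReal_ne_top hle
    have h0 : 0 < (V.val l).toReal := ENNReal.toReal_pos (hpos l) htop
    have h3 : (V.val l).toReal ≤ tol := ENNReal.toReal_le_of_le_ofReal htol.le hle
    have h4 : 1 ≤ tol * (V.val l).toReal⁻¹ := by
      rw [← div_eq_mul_inv, one_le_div h0]; exact h3
    rw [← mul_assoc]
    exact le_mul_of_one_le_left (mul_self_nonneg _) h4

end GenEigen

/-! ### Spectra of products of positive semidefinite matrices -/

section Spectrum

variable {m n : Type*} [Fintype m] [Fintype n]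

theorem rangeProj_transpose (M : Matrix m n ℝ) : (rangeProj M)ᵀ = rangeProj M := by
  have h : (Matrix.toEuclideanLin (rangeProj M)).IsSymmetric := by
    rw [rangeProj, LinearEquiv.apply_symm_apply]
    exact Submodule.starProjection_isSymmetric _
  have := Matrix.isSymmetric_toEuclideanLin_iff.1 h
  rwa [Matrix.IsHermitian, conjTranspose_eq_transpose_of_trivial] at this

theorem rangeProj_mul_self (M : Matrix m n ℝ) : rangeProj M * M = M := by
  refine Matrix.toEuclideanLin.injective (LinearMap.ext fun v => ?_)
  have h : Matrix.toEuclideanLin (rangeProj M * M) v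
      = Matrix.toEuclideanLin (rangeProj M) (Matrix.toEuclideanLin M v) := by
    simp [Matrix.toLpLin_apply, mulVec_mulVec]
  rw [h, rangeProj, LinearEquiv.apply_symm_apply]
  exact Submodule.starProjection_eq_self_iff.2 ⟨v, rfl⟩

/-- The real and imaginary parts of an eigenvector. -/
theorem exists_of_mem_cspec {M : Matrix n n ℝ} {z : ℂ} (hz : z ∈ cspec M) :
    ∃ a b : n → ℝ, (a ≠ 0 ∨ b ≠ 0) ∧ M *ᵥ a = z.re • a - z.im • b ∧
      M *ᵥ b = z.im • a + z.re • b := by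
  rw [cspec, ← Matrix.spectrum_toLin', ← Module.End.hasEigenvalue_iff_mem_spectrum] at hz
  obtain ⟨v, hv⟩ := hz.exists_hasEigenvector
  have hMv := hv.apply_eq_smul
  rw [Matrix.toLin'_apply] at hMv
  refine ⟨fun i => (v i).re, fun i => (v i).im, ?_, ?_, ?_⟩
  · by_contra! h
    exact hv.2 (funext fun i => Complex.ext (congrFun h.1 i) (congrFun h.2 i))
  · funext i
    have := congrArg Complex.re (congrFun hMv i)
    simpa [mulVec, dotProduct] using this
  · funext i
    have := congrArg Complex.im (congrFun hMv i)
    simp [mulVec, dotProduct] at this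
    simp [mulVec, dotProduct, this]
    ring

/-- The eigenvalues of a product of two positive semidefinite matrices are real and nonnegative, and
those that are not zero have real eigenvectors. -/
theorem cspec_mul_posSemidef {M F : Matrix n n ℝ} (hM : M.PosSemidef) (hF : F.PosSemidef) {z : ℂ}
    (hz : z ∈ cspec (M * F)) :
    z.im = 0 ∧ 0 ≤ z.re ∧
      (z ≠ 0 → ∃ x : n → ℝ, (M * F) *ᵥ x = z.re • x ∧ 0 < energy F x) := by
  obtain ⟨a, b, hab, ha, hb⟩ := exists_of_mem_cspec hz
  have hFt := transpose_eq_of_posSemidef hF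
  have hMt := transpose_eq_of_posSemidef hM
  -- `F M F` is symmetric, so that `aᵀ F M F b = bᵀ F M F a`.
  have hsymm : a ⬝ᵥ F *ᵥ ((M * F) *ᵥ b) = b ⬝ᵥ F *ᵥ ((M * F) *ᵥ a) := by
    rw [mulVec_mulVec, mulVec_mulVec]
    exact dotProduct_mulVec_comm (by simp [transpose_mul, hFt, hMt, Matrix.mul_assoc]) a b
  have hab' : b ⬝ᵥ F *ᵥ a = a ⬝ᵥ F *ᵥ b := dotProduct_mulVec_comm hFt b a
  have him : z.im * (energy F a + energy F b) = 0 := by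
    rw [ha, hb] at hsymm
    simp only [mulVec_add, mulVec_sub, mulVec_smul, dotProduct_add, dotProduct_sub,
      dotProduct_smul, smul_eq_mul, hab'] at hsymm
    simp only [energy]
    linarith
  have hka : energy F a = 0 → (M * F) *ᵥ a = 0 := fun h => by
    rw [← mulVec_mulVec, mulVec_eq_zero_of_energy hF h, mulVec_zero]
  have hkb : energy F b = 0 → (M * F) *ᵥ b = 0 := fun h => by
    rw [← mulVec_mulVec, mulVec_eq_zero_of_energy hF h, mulVec_zero]
  have hea := energy_nonneg hF a
  have heb := energy_nonneg hF b
  -- An eigenvector in the kernel of `F` belongs to the eigenvalue zero.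
  have hker : energy F a = 0 → energy F b = 0 → z = 0 := by
    intro h1 h2
    rw [hka h1] at ha
    rw [hkb h2] at hb
    have e1 : ∀ i, (z.re ^ 2 + z.im ^ 2) * a i = 0 := fun i => by
      have p := congrFun ha i
      have q := congrFun hb i
      simp only [Pi.zero_apply, Pi.sub_apply, Pi.add_apply, Pi.smul_apply, smul_eq_mul] at p q
      linear_combination (-z.re) * p - z.im * q
    have e2 : ∀ i, (z.re ^ 2 + z.im ^ 2) * b i = 0 := fun i => by
      have p := congrFun ha i
      have q := congrFun hb i
      simp only [Pi.zero_apply, Pi.sub_apply, Pi.add_apply, Pi.smul_apply, smul_eq_mul] at p q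
      linear_combination z.im * p - z.re * q
    have e3 : z.re ^ 2 + z.im ^ 2 = 0 := by
      by_contra h
      rcases hab with h' | h'
      · exact h' (funext fun i => (mul_eq_zero.1 (e1 i)).resolve_left h)
      · exact h' (funext fun i => (mul_eq_zero.1 (e2 i)).resolve_left h)
    refine Complex.ext ?_ ?_
    · simpa using (by nlinarith [sq_nonneg z.re, sq_nonneg z.im] : z.re ^ 2 = 0)
    · simpa using (by nlinarith [sq_nonneg z.re, sq_nonneg z.im] : z.im ^ 2 = 0)
  by_cases hz0 : z = 0
  · simp [hz0]
  have hpos : 0 < energy F a + energy F b := by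
    rcases hea.lt_or_eq with h | h
    · linarith
    rcases heb.lt_or_eq with h' | h'
    · linarith
    exact absurd (hker h.symm h'.symm) hz0
  have hi : z.im = 0 := (mul_eq_zero.1 him).resolve_right hpos.ne'
  obtain ⟨x, hx, hxpos⟩ : ∃ x : n → ℝ, (M * F) *ᵥ x = z.re • x ∧ 0 < energy F x := by
    rcases hea.lt_or_eq with h | h
    · exact ⟨a, by simpa [hi] using ha, h⟩
    · exact ⟨b, by simpa [hi] using hb, by linarith⟩
  refine ⟨hi, ?_, fun _ => ⟨x, hx, hxpos⟩⟩
  have h1 : z.re * energy F x = energy M (F *ᵥ x) := by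
    have : energy M (F *ᵥ x) = x ⬝ᵥ F *ᵥ ((M * F) *ᵥ x) := by
      rw [← energy_conj, hFt, energy, mulVec_mulVec, Matrix.mul_assoc]
    rw [this, hx, mulVec_smul, dotProduct_smul, energy, smul_eq_mul]
  have h2 := energy_nonneg hM (F *ᵥ x)
  rw [← h1] at h2
  exact nonneg_of_mul_nonneg_left h2 hxpos

/-- If all nonzero eigenvalues lie in `[1, K]`, the condition number is at most `K`. -/
theorem condNumber_le {M : Matrix n n ℝ} {K : ℝ} (hK : 0 ≤ K)
    (h : ∀ z ∈ cspec M, z ≠ 0 → 1 ≤ ‖z‖ ∧ ‖z‖ ≤ K) : condNumber M ≤ K := by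
  rw [condNumber]
  set s := {r : ℝ | ∃ z ∈ cspec M, z ≠ 0 ∧ r = ‖z‖} with hs
  rcases s.eq_empty_or_nonempty with he | hne
  · simpa [he] using hK
  have h1 : ∀ r ∈ s, 1 ≤ r ∧ r ≤ K := by
    rintro r ⟨z, hz, hz0, rfl⟩
    exact h z hz hz0
  have h2 : sSup s ≤ K := csSup_le hne fun r hr => (h1 r hr).2
  have h3 : 1 ≤ sInf s := le_csInf hne fun r hr => (h1 r hr).1
  exact (div_le_self (Real.sSup_nonneg fun r hr => by linarith [(h1 r hr).1]) h3).trans h2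

end Spectrum

/-! ### The abstract projector preconditioner -/

section Projector

variable {m n u : Type*} [Fintype m] [Fintype n] [Fintype u] [DecidableEq m] [DecidableEq n]

/-- The preconditioner with scaled jump matrix `R` for the matrix `B S⁻¹ Bᵀ`, after deflation of
the range of `U`. The averaging operator `Rᵀ B` keeps jumps, and its energy norm on the vectors with
`Uᵀ B w = 0` is at most `√K`. Then all nonzero eigenvalues of the preconditioned matrix lie in
`[1, K]`. -/
theorem cspec_projector {S : Matrix n n ℝ} (hS : S.PosSemidef) (hSu : IsUnit S)
    {B R : Matrix m n ℝ} (hB : ∀ w, B *ᵥ (Rᵀ *ᵥ (B *ᵥ w)) = B *ᵥ w) (U : Matrix m u ℝ) {K : ℝ}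
    (hK : ∀ w, Uᵀ *ᵥ (B *ᵥ w) = 0 → energy S (Rᵀ *ᵥ (B *ᵥ w)) ≤ K * energy S w)
    {F P M : Matrix m m ℝ} (hF : F = B * S⁻¹ * Bᵀ)
    (hP : P = U * pinv (Uᵀ * F * U) * Uᵀ * F)
    (hM : M = (rangeProj B)ᵀ * (1 - P) * (R * S * Rᵀ) * (1 - P)ᵀ * rangeProj B)
    {z : ℂ} (hz : z ∈ cspec (M * F)) :
    z.im = 0 ∧ 0 ≤ z.re ∧ (z ≠ 0 → 1 ≤ z.re ∧ z.re ≤ K) := by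
  have hSi : S⁻¹.PosSemidef := hS.inv
  have hdet : IsUnit S.det := (isUnit_iff_isUnit_det S).1 hSu
  have hFp : F.PosSemidef := by
    have := hSi.mul_mul_conjTranspose_same B
    rwa [conjTranspose_eq_transpose_of_trivial, ← hF] at this
  have hFt := transpose_eq_of_posSemidef hFp
  set M₀ := R * S * Rᵀ
  set Q := rangeProj B with hQ
  have hQF : Q * F = F := by
    rw [hF, ← Matrix.mul_assoc, ← Matrix.mul_assoc, hQ, rangeProj_mul_self]
  have hQt : Qᵀ = Q := rangeProj_transpose B
  have hFQ : F * Q = F := by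
    have := congrArg transpose hQF
    rwa [transpose_mul, hQt, hFt] at this
  -- `P` is the projection onto the range of `U`, orthogonal with respect to `F`.
  obtain ⟨C, hC⟩ := exists_gram hFp
  have hX : (pinv (Uᵀ * F * U))ᵀ = pinv (Uᵀ * F * U) :=
    pinv_transpose_of_symm (by simp [transpose_mul, hFt, Matrix.mul_assoc])
  have hUX : Uᵀ * F * U * pinv (Uᵀ * F * U) * (Uᵀ * F) = Uᵀ * F := by
    have h := gram_mul_pinv_mul_transpose (C * U)
    have e : (C * U)ᵀ * (C * U) = Uᵀ * F * U := by
      rw [transpose_mul, hC]; simp only [Matrix.mul_assoc]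
    rw [e, transpose_mul] at h
    have h' := congrArg (· * C) h
    simpa only [Matrix.mul_assoc, ← hC] using h'
  set X := pinv (Uᵀ * F * U)
  have hFP : Pᵀ * F = F * P := by
    rw [hP]; simp only [transpose_mul, transpose_transpose, hX, hFt, Matrix.mul_assoc]
  have hUP : Uᵀ * F * P = Uᵀ * F := by
    refine Eq.trans ?_ hUX
    rw [hP]; simp only [Matrix.mul_assoc]
  have hFPP : F * P * P = F * P := by
    have : F * P = F * U * X * (Uᵀ * F) := by rw [hP]; simp only [Matrix.mul_assoc]
    rw [this, Matrix.mul_assoc _ (Uᵀ * F) P, hUP]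
  have hF1 : (1 - P)ᵀ * F = F * (1 - P) := by
    rw [transpose_sub, transpose_one, Matrix.sub_mul, Matrix.mul_sub, hFP, Matrix.one_mul,
      Matrix.mul_one]
  have hM₀p : M₀.PosSemidef := by
    have := hS.mul_mul_conjTranspose_same R
    rwa [conjTranspose_eq_transpose_of_trivial] at this
  have hMp : M.PosSemidef := by
    have := hM₀p.mul_mul_conjTranspose_same (Qᵀ * (1 - P))
    rw [conjTranspose_eq_transpose_of_trivial, transpose_mul, transpose_transpose] at this
    rw [hM]
    simpa only [Matrix.mul_assoc] using this
  obtain ⟨him, hre, hex⟩ := cspec_mul_posSemidef hMp hFp hz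
  refine ⟨him, hre, fun hz0 => ?_⟩
  obtain ⟨x, hx, hxpos⟩ := hex hz0
  have hθ : 0 < z.re := by
    refine hre.lt_of_ne fun h => hz0 (Complex.ext h.symm him)
  set θ := z.re
  set y := (1 - P) *ᵥ x with hy
  -- The eigenvector is `F`-orthogonal to the range of `U`.
  have hMF : F * M * F = F * (1 - P) * M₀ * F * (1 - P) := by
    have : F * M * F = F * Q * (1 - P) * M₀ * (1 - P)ᵀ * (Q * F) := by
      rw [hM, hQt]; simp only [Matrix.mul_assoc]
    rw [this, hFQ, hQF, Matrix.mul_assoc _ _ F, hF1]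
    simp only [Matrix.mul_assoc]
  have hPMF : Pᵀ * (F * M * F) = 0 := by
    rw [hMF]
    have : Pᵀ * (F * (1 - P)) = 0 := by
      rw [← Matrix.mul_assoc, hFP, Matrix.mul_sub, Matrix.mul_one, hFPP, sub_self]
    simp only [← Matrix.mul_assoc] at this ⊢
    simp only [this, Matrix.zero_mul]
  have hFMFx : (F * M * F) *ᵥ x = θ • F *ᵥ x := by
    rw [Matrix.mul_assoc, ← mulVec_mulVec, hx, mulVec_smul]
  have hFPx : (F * P) *ᵥ x = 0 := by
    have h := congrArg (fun A => A *ᵥ x) hPMF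
    simp only [zero_mulVec] at h
    rw [← mulVec_mulVec, hFMFx, mulVec_smul, mulVec_mulVec, hFP] at h
    exact (smul_eq_zero.1 h).resolve_left hθ.ne'
  have hFy : F *ᵥ y = F *ᵥ x := by
    rw [hy, mulVec_mulVec, Matrix.mul_sub, Matrix.mul_one, sub_mulVec, hFPx, sub_zero]
  have hEy : energy F y = energy F x := by
    rw [energy, hFy, dotProduct_mulVec_comm hFt, hFy, energy]
  have hθx : θ * energy F x = energy M₀ (F *ᵥ y) := by
    have h1 : energy (F * M * F) x = θ * energy F x := by
      rw [energy, hFMFx, dotProduct_smul, energy, smul_eq_mul]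
    have h2 : F * M * F = (F * (1 - P))ᵀ * M₀ * (F * (1 - P)) := by
      rw [hMF, transpose_mul, hFt, hF1]; simp only [Matrix.mul_assoc]
    rw [← h1, h2, energy_conj, hy, mulVec_mulVec]
  -- The vector `q = S⁻¹ Bᵀ y` represents `y` in the space on which `S` acts.
  set q := S⁻¹ *ᵥ (Bᵀ *ᵥ y) with hq
  have hSq : S *ᵥ q = Bᵀ *ᵥ y := by
    rw [hq, mulVec_mulVec, mul_nonsing_inv S hdet, one_mulVec]
  have hBq : B *ᵥ q = F *ᵥ y := by
    rw [hq, hF, ← mulVec_mulVec, ← mulVec_mulVec]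
  have hEq : energy S q = energy F y := by
    rw [energy, hSq, dotProduct_transpose_mulVec, hBq, energy, dotProduct_comm]
  have hE₀ : energy M₀ (F *ᵥ y) = energy S (Rᵀ *ᵥ (B *ᵥ q)) := by
    rw [hBq, ← energy_conj Rᵀ, transpose_transpose]
  rw [← hEy, ← hEq] at hxpos hθx
  constructor
  · -- `|q|² = ⟨B q, y⟩ = ⟨B Rᵀ B q, y⟩ = ⟨Rᵀ B q, q⟩ ≤ |Rᵀ B q| |q|`
    have h1 : (Rᵀ *ᵥ (B *ᵥ q)) ⬝ᵥ S *ᵥ q = energy S q := by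
      rw [energy, hSq, dotProduct_transpose_mulVec, dotProduct_transpose_mulVec, hB]
    have h2 := dotProduct_sq_le_energy hS (Rᵀ *ᵥ (B *ᵥ q)) q
    rw [h1, ← hE₀, ← hθx] at h2
    have h3 : 1 * energy S q ^ 2 ≤ θ * energy S q ^ 2 := by linarith
    exact le_of_mul_le_mul_right h3 (by positivity)
  · have hU : Uᵀ *ᵥ (B *ᵥ q) = 0 := by
      rw [hBq, hy, mulVec_mulVec, mulVec_mulVec, Matrix.mul_sub, Matrix.mul_one, hUP,
        sub_self, zero_mulVec]
    have h := hK q hU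
    rw [← hE₀, ← hθx] at h
    exact le_of_mul_le_mul_right h hxpos

end Projector

/-! ### The stiffness matrices -/

namespace DecomposedMesh

variable {d N : ℕ} (T : DecomposedMesh d N)

/-- On a cell, the finite element functions have a constant gradient. -/
theorem exists_gradient_onCell (t : T.Cell) (u : T.Node → ℝ) :
    ∃ g : EuclideanSpace ℝ (Fin d), ∀ p, ∇ (T.onCell t u) p = g := by
  set L : EuclideanSpace ℝ (Fin d) →L[ℝ] ℝ :=
    ∑ x : t.1, T.nodal u x • LinearMap.toContinuousLinearMap ((T.cellBasis t).coord x).linear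
    with hL
  refine ⟨(InnerProductSpace.toDual ℝ _).symm L, fun p => ?_⟩
  have h : HasFDerivAt (T.onCell t u) L p := by
    rw [hL]
    refine HasFDerivAt.fun_sum fun x _ => ?_
    refine HasFDerivAt.const_mul ?_ _
    have e : ((T.cellBasis t).coord x : EuclideanSpace ℝ (Fin d) → ℝ)
        = fun q => LinearMap.toContinuousLinearMap ((T.cellBasis t).coord x).linear q
          + (T.cellBasis t).coord x 0 := by
      funext q
      simpa using congrFun (AffineMap.decomp ((T.cellBasis t).coord x)) q
    rw [e]
    exact (ContinuousLinearMap.hasFDerivAt _).add_const _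
  rw [gradient, h.fderiv]

theorem posSemidef_stiffness {rho : EuclideanSpace ℝ (Fin d) → ℝ}
    (hpos : ∀ᵐ p ∂(volume.restrict T.closedDomain), 0 ≤ rho p) (i : Fin N) :
    (T.stiffness rho i).PosSemidef := by
  choose g hg using T.exists_gradient_onCell
  have e : T.stiffness rho i = ∑ t : {t : T.Cell // T.part t = i},
      (∫ p in convexHull ℝ (t.1.1 : Set (EuclideanSpace ℝ (Fin d))), rho p) •
        Matrix.gram ℝ fun x : XDof T.own i => g t.1 (Pi.single x.1 1) := by
    ext x y
    simp only [stiffness, localForm, of_apply, Matrix.sum_apply, Matrix.smul_apply, Matrix.gram_apply,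
      hg, integral_mul_const, smul_eq_mul]
  rw [e]
  refine posSemidef_sum _ fun t _ => (Matrix.posSemidef_gram ℝ _).smul ?_
  have hsub : convexHull ℝ (t.1.1 : Set (EuclideanSpace ℝ (Fin d))) ⊆ T.closedDomain :=
    T.complex.convexHull_subset_space t.1.2.1
  exact integral_nonneg_of_ae (ae_restrict_of_ae_restrict_of_subset hsub hpos)

end DecomposedMesh

/-! ### The jump operators -/

/-- A sum over ordered pairs that contain `i`, in which the sign changes with the position of `i`, as
a sum over all partners of `i`. -/
theorem sum_pairs_signed {ι : Type*} [Fintype ι] [LinearOrder ι] (i : ι) (g v : ι → ℝ) :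
    ∑ p : {p : ι × ι // p.1 < p.2}, (if i = p.1.1 then g p.1.2
        else if i = p.1.2 then -g p.1.1 else 0) * (v p.1.1 - v p.1.2)
      = ∑ l ∈ Finset.univ.erase i, g l * (v i - v l) := by
  have h1 : ∑ p : {p : ι × ι // p.1 < p.2}, (if i = p.1.1 then g p.1.2
        else if i = p.1.2 then -g p.1.1 else 0) * (v p.1.1 - v p.1.2)
      = ∑ p : {p : ι × ι // p.1 < p.2}, ((if i = p.1.1 then g p.1.2 * (v i - v p.1.2) else 0)
        + if i = p.1.2 then g p.1.1 * (v i - v p.1.1) else 0) := by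
    refine Finset.sum_congr rfl fun ⟨⟨a, b⟩, hab⟩ _ => ?_
    dsimp only
    by_cases ha : i = a
    · subst ha
      simp [ne_of_lt hab]
    · by_cases hb : i = b
      · subst hb
        simp only [ha, if_false, if_true, zero_add]
        ring
      · simp [ha, hb]
  rw [h1, ← Finset.sum_subtype (Finset.univ.filter fun p : ι × ι => p.1 < p.2) (by simp)
    (fun p : ι × ι => (if i = p.1 then g p.2 * (v i - v p.2) else 0)
        + if i = p.2 then g p.1 * (v i - v p.1) else 0), Finset.sum_filter, Fintype.sum_prod_type]
  have h2 : ∀ a b : ι, (if a < b then (if i = a then g b * (v i - v b) else 0)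
        + (if i = b then g a * (v i - v a) else 0) else 0)
      = (if i = a then (if i < b then g b * (v i - v b) else 0) else 0)
        + (if i = b then (if a < i then g a * (v i - v a) else 0) else 0) := by
    intro a b
    by_cases ha : i = a <;> by_cases hb : i = b <;> by_cases hab : a < b <;> simp_all
  simp only [h2, Finset.sum_add_distrib, Finset.sum_ite_eq, Finset.mem_univ, if_true]
  rw [Finset.sum_comm (s := Finset.univ) (t := Finset.univ)]
  simp only [Finset.sum_ite_eq, Finset.mem_univ, if_true]
  rw [← Finset.sum_add_distrib, ← Finset.filter_ne', Finset.sum_filter]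
  refine Finset.sum_congr rfl fun l _ => ?_
  rcases lt_trichotomy i l with h | h | h
  · simp [h, h.ne', h.not_gt]
  · simp [h]
  · simp [h, h.ne, h.not_gt]

section Jump

variable {N : ℕ} {ν : Type} [Fintype ν] {own : ν → Finset (Fin N)} (cl : InterfaceClasses own)

/-- A function on the dual nodes that vanishes outside of a class is summed over the class. -/
theorem sum_dual_eq_sum_classNode (c : cl.Class) (f : cl.Dual → ℝ)
    (hf : ∀ x, cl.cls x ≠ c → f x = 0) : ∑ x, f x = ∑ x : cl.ClassNode c, f x.1 := by
  rw [← Finset.sum_subtype (Finset.univ.filter fun x => cl.cls x = c) (by simp) f,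
    Finset.sum_filter]
  refine Finset.sum_congr rfl fun x _ => ?_
  by_cases h : cl.cls x = c
  · simp [h]
  · simp [h, hf x h]

/-- The values of `w ∈ W̃` on the nodes of the class `c`, as seen from the subdomain `i`. -/
def classTrace (w : cl.TildeDof → ℝ) (c : cl.Class) (i : ↥(cl.I c)) : cl.ClassNode c → ℝ :=
  fun x => w (.inl ⟨x.1, ⟨i.1, by rw [x.2]; exact i.2⟩⟩)

theorem B_mulVec (w : cl.TildeDof → ℝ) (μ : cl.Multiplier) :
    (cl.B *ᵥ w) μ = w (.inl ⟨μ.1, μ.2.1.1⟩) - w (.inl ⟨μ.1, μ.2.1.2⟩) := by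
  obtain ⟨x, ⟨⟨a, b⟩, hab⟩⟩ := μ
  have hne : a ≠ b := ne_of_lt hab
  simp only [mulVec, dotProduct, Fintype.sum_sum_type, InterfaceClasses.B, of_apply,
    Sum.elim_inl, Sum.elim_inr, zero_mul, Finset.sum_const_zero, add_zero, Fintype.sum_sigma]
  rw [Finset.sum_eq_single x (fun y _ hy => by simp [hy]) (by simp)]
  have : ∀ i : ↥(cl.I (cl.cls x)),
      (if x = x then (if (i : Fin N) = a then (1 : ℝ) else if (i : Fin N) = b then -1 else 0) else 0)
        * w (.inl ⟨x, i⟩)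
      = (if i = a then w (.inl ⟨x, i⟩) else 0) - if i = b then w (.inl ⟨x, i⟩) else 0 := by
    intro i
    simp only [if_true, ← Subtype.ext_iff]
    by_cases ha : i = a
    · have : i ≠ b := ha ▸ hne
      simp [ha, hne]
    · by_cases hb : i = b <;> simp [ha, hb, hne.symm]
  rw [Finset.sum_congr rfl fun i _ => this i, Finset.sum_sub_distrib]
  simp

theorem BD_transpose_mulVec_inr (D : cl.Scaling) (y : cl.Multiplier → ℝ) (v : cl.Primal) :
    ((cl.BD D)ᵀ *ᵥ y) (.inr v) = 0 := by
  simp [mulVec, dotProduct, InterfaceClasses.BD]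

/-- The operator `B_Dᵀ B` maps `w` to the scaled sum of its jumps. -/
theorem classTrace_BD_transpose_mulVec (D : cl.Scaling) (w : cl.TildeDof → ℝ) (c : cl.Class)
    (i : ↥(cl.I c)) :
    classTrace cl ((cl.BD D)ᵀ *ᵥ (cl.B *ᵥ w)) c i
      = ∑ l ∈ Finset.univ.erase i, D c l *ᵥ (classTrace cl w c i - classTrace cl w c l) := by
  funext x'
  simp only [Finset.sum_apply, mulVec, dotProduct, classTrace]
  rw [Finset.sum_comm, Fintype.sum_sigma, sum_dual_eq_sum_classNode cl c]
  · refine Finset.sum_congr rfl fun x _ => ?_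
    obtain ⟨x', h'⟩ := x'
    obtain ⟨x, hx⟩ := x
    subst hx
    have hB := B_mulVec cl w
    simp only [mulVec, dotProduct] at hB
    simp only [hB, transpose_apply, InterfaceClasses.BD, of_apply, Sum.elim_inl, h', dite_true]
    exact Eq.trans (Finset.sum_congr rfl fun p _ => by
        simp only [← Subtype.ext_iff]; split_ifs <;> rfl)
      (sum_pairs_signed i (fun l => D (cl.cls x) l ⟨x', h'⟩ ⟨x, rfl⟩) fun l => w (.inl ⟨x, l⟩))
  · intro x hx
    refine Finset.sum_eq_zero fun p _ => ?_
    have : cl.cls x'.1 ≠ cl.cls x := fun h => hx (h.symm.trans x'.2)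
    simp [InterfaceClasses.BD, this]

/-- With a partition of unity, `B_Dᵀ B w` differs from `w` by averages, which have no jumps. -/
theorem B_BD_transpose_B_mulVec {D : cl.Scaling} (hD : cl.IsPartitionOfUnity D)
    (w : cl.TildeDof → ℝ) : cl.B *ᵥ ((cl.BD D)ᵀ *ᵥ (cl.B *ᵥ w)) = cl.B *ᵥ w := by
  have key : ∀ c i, classTrace cl ((cl.BD D)ᵀ *ᵥ (cl.B *ᵥ w)) c i
      = classTrace cl w c i - ∑ l, D c l *ᵥ classTrace cl w c l := by
    intro c i
    rw [classTrace_BD_transpose_mulVec, Finset.sum_erase _ (by simp)]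
    simp only [mulVec_sub, Finset.sum_sub_distrib]
    rw [← sum_mulVec, hD c, one_mulVec]
  funext μ
  obtain ⟨x, ⟨⟨a, b⟩, hab⟩⟩ := μ
  have ha := congrFun (key (cl.cls x) a) ⟨x, rfl⟩
  have hb := congrFun (key (cl.cls x) b) ⟨x, rfl⟩
  simp only [classTrace, Pi.sub_apply] at ha hb
  rw [B_mulVec, B_mulVec, ha, hb]
  ring

variable {cl} {A : LocalMatrices own} {D : cl.Scaling}

/-- `Uᵀ B w = 0` says that the jumps of `w` are orthogonal to the chosen eigenvectors. -/
theorem orthogonal_of_U_transpose_mulVec {V : EigenChoice cl A D} {tol : ℝ}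
    {w : cl.TildeDof → ℝ} (hw : (U V tol)ᵀ *ᵥ (cl.B *ᵥ w) = 0) (c : cl.Class)
    (i j : ↥(cl.I c)) {l : cl.ClassNode c} (hl : IsChosen V tol c l) :
    (eigLeft cl A D c *ᵥ (V c).vec l) ⬝ᵥ (classTrace cl w c i - classTrace cl w c j) = 0 := by
  have key : ∀ i j : ↥(cl.I c), i < j →
      (eigLeft cl A D c *ᵥ (V c).vec l) ⬝ᵥ (classTrace cl w c i - classTrace cl w c j) = 0 := by
    intro i j hij
    have h := congrFun hw ⟨c, ⟨(i, j), hij⟩, ⟨l, hl⟩⟩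
    rw [Pi.zero_apply] at h
    rw [← h, mulVec, dotProduct, dotProduct, Fintype.sum_sigma, sum_dual_eq_sum_classNode cl c]
    · refine Finset.sum_congr rfl fun x _ => ?_
      obtain ⟨x, hx⟩ := x
      subst hx
      rw [Finset.sum_eq_single ⟨(i, j), hij⟩]
      · simp [U, B_mulVec, classTrace]
      · rintro ⟨⟨a, b⟩, hab⟩ _ hne
        have : ¬ (a = i ∧ b = j) := by
          rintro ⟨ha, hb⟩
          exact hne (Subtype.ext (Prod.ext ha hb))
        simp only [transpose_apply, U, of_apply, mul_eq_zero, dite_eq_right_iff]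
        refine Or.inl ?_
        rintro ⟨-, ha, hb⟩
        exact absurd ⟨Subtype.ext ha, Subtype.ext hb⟩ this
      · simp
    · intro x hx
      refine Finset.sum_eq_zero fun p _ => ?_
      simp [U, hx]
  rcases lt_trichotomy i j with h | h | h
  · exact key i j h
  · simp [h]
  · rw [← neg_sub, dotProduct_neg, key j i h, neg_zero]

/-! ### Restriction to subdomains -/

theorem Rtilde_mulVec_dual (i : Fin N) (w : cl.TildeDof → ℝ) (x : WDof own i)
    (hx : ¬ cl.IsVertex x.1) :
    (Rtilde cl i *ᵥ w) x = w (.inl ⟨⟨x.1, x.2.2, hx⟩, ⟨i, x.2.1⟩⟩) := by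
  rw [mulVec, dotProduct, Fintype.sum_sum_type,
    Finset.sum_eq_single ⟨⟨x.1, x.2.2, hx⟩, ⟨i, x.2.1⟩⟩, Finset.sum_eq_zero, add_zero]
  · simp [Rtilde]
  · intro v _
    have : (v : ν) ≠ x.1 := fun h => hx (h ▸ v.2.2)
    simp [Rtilde, this]
  · rintro ⟨⟨y, hy⟩, ⟨j, hj⟩⟩ _ hne
    have : ¬ (y = x.1 ∧ j = i) := by
      rintro ⟨rfl, rfl⟩
      exact hne rfl
    simp [Rtilde, this]
  · simp

theorem Rtilde_mulVec_primal (i : Fin N) (w : cl.TildeDof → ℝ) (x : WDof own i)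
    (hx : cl.IsVertex x.1) : (Rtilde cl i *ᵥ w) x = w (.inr ⟨x.1, x.2.2, hx⟩) := by
  rw [mulVec, dotProduct, Fintype.sum_sum_type, Finset.sum_eq_zero, zero_add,
    Finset.sum_eq_single ⟨x.1, x.2.2, hx⟩]
  · simp [Rtilde]
  · rintro ⟨v, hv⟩ _ hne
    have : v ≠ x.1 := by
      rintro rfl
      exact hne rfl
    simp [Rtilde, this]
  · simp
  · rintro ⟨⟨y, hy⟩, j⟩ _
    have : y ≠ x.1 := fun h => hy.2 (h ▸ hx)
    simp [Rtilde, this]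

omit [Fintype ν] in
theorem classIncl_injective (c : cl.Class) (i : ↥(cl.I c)) :
    Function.Injective (classIncl cl c i) := by
  intro x y h
  have h' : x.1.1 = y.1.1 := congrArg (fun z => z.1) h
  exact Subtype.ext (Subtype.ext h')

theorem Rtilde_mulVec_comp_classIncl (w : cl.TildeDof → ℝ) (c : cl.Class) (i : ↥(cl.I c)) :
    (Rtilde cl i *ᵥ w) ∘ classIncl cl c i = classTrace cl w c i := by
  funext x
  rw [Function.comp, Rtilde_mulVec_dual _ _ _ x.1.2.2]
  rfl

theorem energy_Stilde (w : cl.TildeDof → ℝ) :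
    energy (Stilde cl A) w = ∑ i, energy (S A i) (Rtilde cl i *ᵥ w) := by
  rw [Stilde, energy_sum_left]
  exact Finset.sum_congr rfl fun i _ => energy_conj _ _ _

theorem posSemidef_S (hA : ∀ i, (A i).PosSemidef) (i : Fin N) : (S A i).PosSemidef :=
  posSemidef_schur (hA i) _

theorem posSemidef_Stilde (hA : ∀ i, (A i).PosSemidef) : (Stilde cl A).PosSemidef := by
  refine posSemidef_sum _ fun i _ => ?_
  have := (posSemidef_S hA i).conjTranspose_mul_mul_same (Rtilde cl i)
  rwa [conjTranspose_eq_transpose_of_trivial] at this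

/-- The part of the restriction of `w` to the subdomain `i` that lives on the class `c`. -/
def piece (w : cl.TildeDof → ℝ) (c : cl.Class) (i : Fin N) : WDof own i → ℝ :=
  fun x => if ∃ y : cl.ClassNode c, y.1.1 = x.1 then (Rtilde cl i *ᵥ w) x else 0

/-- The energy of a vector supported on the range of `f` is that of the corresponding block. -/
theorem energy_of_support {m k : Type*} [Fintype m] [Fintype k] (M : Matrix m m ℝ) {f : k → m}
    (hf : Function.Injective f) {z : m → ℝ} (hz : ∀ x, x ∉ Set.range f → z x = 0) :
    energy M z = energy (M.submatrix f f) (z ∘ f) := by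
  have h : ∀ g : m → ℝ, ∑ x, g x * z x = ∑ x, g (f x) * z (f x) := by
    intro g
    rw [← Finset.sum_image (s := Finset.univ) (g := f) (f := fun x => g x * z x)
      (fun _ _ _ _ h => hf h)]
    refine (Finset.sum_subset (Finset.subset_univ _) fun x _ hx => ?_).symm
    rw [hz x (by simpa using hx), mul_zero]
  rw [energy, energy, dotProduct_comm z, dotProduct_comm (z ∘ f)]
  simp only [dotProduct, mulVec, h, Function.comp, submatrix_apply]

theorem energy_piece (w : cl.TildeDof → ℝ) (c : cl.Class) (i : ↥(cl.I c)) :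
    energy (S A i) (piece w c i) = energy (Sblock cl A c i) (classTrace cl w c i) := by
  rw [energy_of_support (S A i) (classIncl_injective c i), Sblock]
  · congr 1
    rw [← Rtilde_mulVec_comp_classIncl]
    funext x
    exact if_pos ⟨x, rfl⟩
  · intro x hx
    refine if_neg ?_
    rintro ⟨y, hy⟩
    exact hx ⟨y, Subtype.ext hy⟩

theorem mem_faces {i : Fin N} {c : cl.Class} : c ∈ cl.faces i ↔ i ∈ cl.I c ∧ cl.IsFace c := by
  rw [InterfaceClasses.faces, Finset.mem_filter_univ]

theorem mem_edges {i : Fin N} {c : cl.Class} : c ∈ cl.edges i ↔ i ∈ cl.I c ∧ cl.IsEdge c := by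
  rw [InterfaceClasses.edges, Finset.mem_filter_univ]

/-- A vector that vanishes at the vertices is the sum of its pieces on the faces and the edges. -/
theorem Rtilde_mulVec_eq_sum_piece (w : cl.TildeDof → ℝ) (hw : ∀ v, w (.inr v) = 0) (i : Fin N) :
    Rtilde cl i *ᵥ w = ∑ c ∈ cl.faces i, piece w c i + ∑ c ∈ cl.edges i, piece w c i := by
  funext x
  simp only [Pi.add_apply, Finset.sum_apply]
  by_cases hx : cl.IsVertex x.1
  · have h0 : (Rtilde cl i *ᵥ w) x = 0 := by rw [Rtilde_mulVec_primal _ _ _ hx, hw]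
    simp [piece, h0]
  · set c₀ := cl.cls ⟨x.1, x.2.2, hx⟩ with hc₀
    have h1 : piece w c₀ i x = (Rtilde cl i *ᵥ w) x := if_pos ⟨⟨_, rfl⟩, rfl⟩
    have h2 : ∀ c, c ≠ c₀ → piece w c i x = 0 := by
      intro c hc
      refine if_neg ?_
      rintro ⟨⟨y, hy⟩, h⟩
      refine hc ?_
      rw [← hy, hc₀]
      congr 1
      exact Subtype.ext h
    have hI : i ∈ cl.I c₀ := x.2.1
    have hcard : 2 ≤ (cl.I c₀).card := x.2.2
    have h3 : ∀ s : Finset cl.Class, ∑ c ∈ s, piece w c i x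
        = if c₀ ∈ s then (Rtilde cl i *ᵥ w) x else 0 := by
      intro s
      rw [← h1, ← Finset.sum_ite_eq s c₀ fun c => piece w c i x]
      refine Finset.sum_congr rfl fun c _ => ?_
      by_cases h : c₀ = c
      · simp [h]
      · simp [h, h2 c (Ne.symm h)]
    rw [h3, h3]
    rcases hcard.eq_or_lt with h | h
    · have hE : c₀ ∉ cl.edges i := fun h' => absurd (mem_edges.1 h').2 h.not_lt
      rw [if_pos (mem_faces.2 ⟨hI, h.symm⟩), if_neg hE, add_zero]
    · have hF : c₀ ∉ cl.faces i := fun h' => absurd (mem_faces.1 h').2 h.ne'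
      rw [if_pos (mem_edges.2 ⟨hI, h⟩), if_neg hF, zero_add]

/-! ### The estimate on a face or edge -/

theorem posSemidef_Sblock (hA : ∀ i, (A i).PosSemidef) (c : cl.Class) (i : ↥(cl.I c)) :
    (Sblock cl A c i).PosSemidef :=
  (posSemidef_S hA i).submatrix _

theorem posSemidef_eigLeft (hA : ∀ i, (A i).PosSemidef) (c : cl.Class) :
    (eigLeft cl A D c).PosSemidef := by
  refine posSemidef_sum _ fun m _ => posSemidef_sum _ fun l _ => ?_
  have := (posSemidef_Sblock hA c m).conjTranspose_mul_mul_same (D c l)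
  rwa [conjTranspose_eq_transpose_of_trivial] at this

theorem posSemidef_of_mem_map_Sschur (hA : ∀ i, (A i).PosSemidef) (c : cl.Class) :
    ∀ M ∈ ((Finset.univ : Finset ↥(cl.I c)).sort (· ≤ ·)).map (Sschur cl A c),
      M.PosSemidef := by
  intro M hM
  obtain ⟨i, -, rfl⟩ := List.mem_map.1 hM
  exact posSemidef_schur (posSemidef_S hA i) _

theorem energy_eigRight_classTrace_le (hA : ∀ i, (A i).PosSemidef) (w : cl.TildeDof → ℝ)
    (c : cl.Class) (i : ↥(cl.I c)) :
    energy (eigRight cl A c) (classTrace cl w c i) ≤ energy (S A i) (Rtilde cl i *ᵥ w) := by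
  refine (energy_parSumList_le (posSemidef_of_mem_map_Sschur hA c)
    (List.mem_map_of_mem (a := i) (by simp)) _).trans ?_
  rw [← Rtilde_mulVec_comp_classIncl]
  exact energy_schur_le (posSemidef_S hA i) (classIncl_injective c i) _

/-- The energy of `B_Dᵀ B w` on a face or edge `c`, for `w` that satisfy the adaptive
constraints. The jump between two subdomains is the difference of their deviations from the mean over
the subdomains that share `c`. Estimating the energies of the deviations by the eigenvalue problem,
instead of those of the jumps, makes the bound linear in the number of these subdomains. -/
theorem sum_energy_piece_le (hA : ∀ i, (A i).PosSemidef) {V : EigenChoice cl A D} {tol : ℝ}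
    (htol : 0 < tol) {w : cl.TildeDof → ℝ} (hw : (U V tol)ᵀ *ᵥ (cl.B *ᵥ w) = 0)
    (c : cl.Class) (hc : 1 ≤ (cl.I c).card) :
    ∑ i ∈ cl.I c, energy (S A i) (piece ((cl.BD D)ᵀ *ᵥ (cl.B *ᵥ w)) c i)
      ≤ 2 * ((cl.I c).card - 1) * tol * ∑ i ∈ cl.I c, energy (S A i) (Rtilde cl i *ᵥ w) := by
  rw [← Finset.sum_coe_sort (cl.I c), ← Finset.sum_coe_sort (cl.I c)]
  simp only [energy_piece, classTrace_BD_transpose_mulVec]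
  set t := classTrace cl w c with ht
  set r : ℝ := (Fintype.card ↥(cl.I c) : ℝ) with hr
  have hrc : r = (cl.I c).card := by rw [hr, Fintype.card_coe]
  have hr1 : (1 : ℝ) ≤ r := by rw [hrc]; exact_mod_cast hc
  set u : ↥(cl.I c) → cl.ClassNode c → ℝ := fun i => t i - r⁻¹ • ∑ j, t j with hu
  set T : ↥(cl.I c) → ↥(cl.I c) → ↥(cl.I c) → ℝ :=
    fun m k l => energy (Sblock cl A c k) (D c l *ᵥ u m) with hT
  have hT0 : ∀ m k l, 0 ≤ T m k l := fun m k l => energy_nonneg (posSemidef_Sblock hA c k) _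
  -- The deviations satisfy the constraints, since they are means of jumps.
  have hdev : ∀ i, u i = r⁻¹ • ∑ j, (t i - t j) := by
    intro i
    rw [Finset.sum_sub_distrib, Finset.sum_const, Finset.card_univ, smul_sub,
      ← Nat.cast_smul_eq_nsmul ℝ, ← hr, smul_smul, inv_mul_cancel₀ (by positivity), one_smul]
  have h1 : ∀ i, energy (eigLeft cl A D c) (u i) ≤ tol * energy (eigRight cl A c) (u i) := by
    intro i
    refine (V c).energy_le htol (fun l hl => ?_)
      (transpose_eq_of_posSemidef (posSemidef_eigLeft hA c))
    have hch : IsChosen V tol c l := by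
      rw [IsChosen]
      split_ifs
      exacts [hl.le, hl]
    rw [hdev, dotProduct_smul, dotProduct_sum,
      Finset.sum_eq_zero fun j _ => orthogonal_of_U_transpose_mulVec hw c i j hch, smul_zero]
  have h2 : ∑ i, energy (eigLeft cl A D c) (u i)
      ≤ tol * ∑ i, energy (S A (i : ↥(cl.I c))) (Rtilde cl i *ᵥ w) := by
    refine (Finset.sum_le_sum fun i _ => h1 i).trans ?_
    rw [← Finset.mul_sum]
    refine mul_le_mul_of_nonneg_left ?_ htol.le
    refine (sum_energy_sub_mean_le
      (posSemidef_parSumList (posSemidef_of_mem_map_Sschur hA c)) t).trans ?_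
    exact Finset.sum_le_sum fun i _ => energy_eigRight_classTrace_le hA w c i
  have h3 : ∑ i, energy (eigLeft cl A D c) (u i)
      = ∑ k, ∑ l ∈ Finset.univ.erase k, ∑ m, T m k l := by
    simp only [eigLeft, energy_sum_left, energy_conj]
    rw [Finset.sum_comm]
    exact Finset.sum_congr rfl fun k _ => Finset.sum_comm
  -- The terms with `m = k` and those with `m = l` are disjoint parts of the last sum.
  have h4 : ∑ k, ∑ l ∈ Finset.univ.erase k, (T k k l + T l k l)
      ≤ ∑ k, ∑ l ∈ Finset.univ.erase k, ∑ m, T m k l := by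
    refine Finset.sum_le_sum fun k _ => Finset.sum_le_sum fun l hl => ?_
    rw [← Finset.sum_pair (f := fun m => T m k l) (Finset.ne_of_mem_erase hl).symm]
    exact Finset.sum_le_sum_of_subset_of_nonneg (Finset.subset_univ _) fun m _ _ => hT0 m k l
  have h5 : ∀ k, energy (Sblock cl A c k)
        (∑ l ∈ Finset.univ.erase k, D c l *ᵥ (t k - t l))
      ≤ 2 * (r - 1) * ∑ l ∈ Finset.univ.erase k, (T k k l + T l k l) := by
    intro k
    refine (energy_sum_le (posSemidef_Sblock hA c k) _ _).trans ?_
    have hcard : ((Finset.univ.erase k).card : ℝ) = r - 1 := by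
      rw [Finset.card_erase_of_mem (Finset.mem_univ k), Finset.card_univ, hr,
        Nat.cast_sub (Fintype.card_pos_iff.2 ⟨k⟩), Nat.cast_one]
    rw [hcard, mul_comm 2, mul_assoc, Finset.mul_sum (a := (2 : ℝ))]
    refine mul_le_mul_of_nonneg_left (Finset.sum_le_sum fun l _ => ?_) (by linarith)
    have : t k - t l = u k - u l := by simp only [hu]; abel
    rw [this, mulVec_sub]
    exact energy_sub_le (posSemidef_Sblock hA c k) _ _
  rw [← hrc]
  calc _ ≤ ∑ k, 2 * (r - 1) * ∑ l ∈ Finset.univ.erase k, (T k k l + T l k l) :=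
        Finset.sum_le_sum fun k _ => h5 k
    _ = 2 * (r - 1) * ∑ k, ∑ l ∈ Finset.univ.erase k, (T k k l + T l k l) := by
        rw [Finset.mul_sum]
    _ ≤ 2 * (r - 1) * (tol * ∑ i, energy (S A (i : ↥(cl.I c))) (Rtilde cl i *ᵥ w)) := by
        refine mul_le_mul_of_nonneg_left ?_ (by linarith)
        exact h4.trans (h3 ▸ h2)
    _ = _ := by ring

end Jump

/-! ### Summation over the subdomains -/

/-- Suppose that, for every `c`, the sum of `α i c` over the indices `i ∈ I c` is bounded by that of
`β i`, with the factor `b c * t`. When both are summed over `c`, with every `i` weighted by the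
number of the sets `I c` that contain it, the factor is a bound for the products of `b c` and two
such numbers. Only indices that occur in a common set matter, so the bound can be a maximum of
quantities of single indices. -/
theorem sum_card_mul_sum_le {ι κ : Type*} [Fintype ι] [DecidableEq ι] (I : κ → Finset ι)
    (G : Finset κ) {α : ι → κ → ℝ} {β : ι → ℝ} {b : κ → ℝ} {t M : ℝ}
    (hα : ∀ i c, 0 ≤ α i c) (hβ : ∀ i, 0 ≤ β i) (ht : 0 ≤ t) (hM : 0 ≤ M)
    (hN : ∀ c ∈ G, ∀ i ∈ I c, ∀ j ∈ I c,
      b c * (G.filter (i ∈ I ·)).card * (G.filter (j ∈ I ·)).card ≤ M)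
    (h : ∀ c ∈ G, ∑ i ∈ I c, α i c ≤ b c * t * ∑ i ∈ I c, β i) :
    ∑ i, ((G.filter (i ∈ I ·)).card : ℝ) * ∑ c ∈ G.filter (i ∈ I ·), α i c
      ≤ M * t * ∑ i, β i := by
  set n : ι → ℝ := fun i => ((G.filter (i ∈ I ·)).card : ℝ) with hn
  have hn0 : ∀ i, 0 ≤ n i := fun i => Nat.cast_nonneg _
  have hn1 : ∀ c ∈ G, ∀ j ∈ I c, 0 < n j := fun c hc j hj => by
    have : 0 < (G.filter (j ∈ I ·)).card := Finset.card_pos.2 ⟨c, by simp [hc, hj]⟩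
    exact Nat.cast_pos.2 this
  have swap : ∀ f : ι → κ → ℝ,
      ∑ i, ∑ c ∈ G.filter (i ∈ I ·), f i c = ∑ c ∈ G, ∑ i ∈ I c, f i c := by
    intro f
    simp only [Finset.sum_filter]
    rw [Finset.sum_comm]
    exact Finset.sum_congr rfl fun c _ => by rw [← Finset.sum_filter]; simp
  have hc : ∀ c ∈ G, ∑ i ∈ I c, n i * α i c ≤ ∑ j ∈ I c, t * (M / n j) * β j := by
    intro c hc
    rcases (I c).eq_empty_or_nonempty with he | hne
    · simp [he]
    -- The largest weight in `I c` times that of any `j ∈ I c` is still controlled by `M`.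
    obtain ⟨i₀, hi₀, hmax⟩ := (I c).exists_max_image n hne
    calc ∑ i ∈ I c, n i * α i c ≤ ∑ i ∈ I c, n i₀ * α i c :=
          Finset.sum_le_sum fun i hi => mul_le_mul_of_nonneg_right (hmax i hi) (hα i c)
      _ = n i₀ * ∑ i ∈ I c, α i c := by rw [Finset.mul_sum]
      _ ≤ n i₀ * (b c * t * ∑ j ∈ I c, β j) := mul_le_mul_of_nonneg_left (h c hc) (hn0 _)
      _ = ∑ j ∈ I c, t * (b c * n i₀) * β j := by
          rw [Finset.mul_sum, Finset.mul_sum]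
          exact Finset.sum_congr rfl fun j _ => by ring
      _ ≤ _ := by
          refine Finset.sum_le_sum fun j hj => mul_le_mul_of_nonneg_right ?_ (hβ j)
          refine mul_le_mul_of_nonneg_left ?_ ht
          rw [le_div_iff₀ (hn1 c hc j hj)]
          exact hN c hc i₀ hi₀ j hj
  calc ∑ i, n i * ∑ c ∈ G.filter (i ∈ I ·), α i c
      = ∑ c ∈ G, ∑ i ∈ I c, n i * α i c := by
        rw [← swap]; simp only [Finset.mul_sum]
    _ ≤ ∑ c ∈ G, ∑ j ∈ I c, t * (M / n j) * β j := Finset.sum_le_sum hc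
    _ = ∑ j, n j * (t * (M / n j) * β j) := by
        rw [← swap]
        exact Finset.sum_congr rfl fun j _ => by rw [Finset.sum_const, nsmul_eq_mul]
    _ ≤ ∑ j, M * t * β j := by
        refine Finset.sum_le_sum fun j _ => ?_
        rcases (hn0 j).eq_or_lt with h0 | h0
        · rw [← h0, zero_mul]
          exact mul_nonneg (mul_nonneg hM ht) (hβ j)
        · refine le_of_eq ?_
          field_simp
    _ = _ := by rw [Finset.mul_sum]

section Bound

variable {N : ℕ} {ν : Type} [Fintype ν] {own : ν → Finset (Fin N)} {cl : InterfaceClasses own}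
  {A : LocalMatrices own} {D : cl.Scaling}

variable (cl) in
theorem faces_mul_faces_le_boundConst {c : cl.Class} (hc : cl.IsFace c) (i j : Fin N) :
    8 * (((cl.I c).card - 1) * (cl.faces i).card * (cl.faces j).card) ≤ cl.boundConst := by
  rw [InterfaceClasses.boundConst]
  refine Nat.mul_le_mul_left 8 (le_trans ?_ (le_max_left _ _))
  rw [show (cl.I c).card = 2 from hc, Nat.add_one_sub_one, one_mul]
  have h : ∀ k : Fin N, (cl.faces k).card ^ 2
      ≤ Finset.univ.sup fun i => (cl.faces i).card ^ 2 := fun k =>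
    Finset.le_sup (f := fun i => (cl.faces i).card ^ 2) (Finset.mem_univ k)
  rcases le_total (cl.faces i).card (cl.faces j).card with h' | h'
  · exact (Nat.mul_le_mul_right _ h').trans (by simpa [pow_two] using h j)
  · exact (Nat.mul_le_mul_left _ h').trans (by simpa [pow_two] using h i)

variable (cl) in
/-- Two subdomains that share an edge both have it among their edges, so its number of subdomains is
controlled at whichever of the two has more edges. -/
theorem edges_mul_edges_le_boundConst {c : cl.Class} (hc : cl.IsEdge c) {i j : Fin N} (hi : i ∈ cl.I c)
    (hj : j ∈ cl.I c) :
    8 * (((cl.I c).card - 1) * (cl.edges i).card * (cl.edges j).card) ≤ cl.boundConst := by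
  rw [InterfaceClasses.boundConst]
  refine Nat.mul_le_mul_left 8 (le_trans ?_ (le_max_right _ _))
  have h : ∀ k ∈ cl.I c, (cl.edges k).card ^ 2 * ((cl.I c).card - 1) ≤ Finset.univ.sup fun i =>
      (cl.edges i).card ^ 2 * (cl.edges i).sup fun c => (cl.I c).card := by
    intro k hk
    refine le_trans (Nat.mul_le_mul_left _ ((Nat.sub_le _ 1).trans ?_)) (Finset.le_sup
      (f := fun i => (cl.edges i).card ^ 2 * (cl.edges i).sup fun c => (cl.I c).card)
      (Finset.mem_univ k))
    exact Finset.le_sup (f := fun c => (cl.I c).card) (mem_edges.2 ⟨hk, hc⟩)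
  rcases le_total (cl.edges i).card (cl.edges j).card with h' | h'
  · refine le_trans ?_ (h j hj)
    rw [pow_two, mul_comm, mul_comm ((cl.I c).card - 1), ← mul_assoc]
    gcongr
  · refine le_trans ?_ (h i hi)
    rw [pow_two, mul_assoc, mul_comm ((cl.I c).card - 1)]
    gcongr

/-- The energy estimate for `B_Dᵀ B` on the vectors that satisfy the adaptive constraints. -/
theorem energy_BD_transpose_B_le (hA : ∀ i, (A i).PosSemidef) {V : EigenChoice cl A D} {tol : ℝ}
    (htol : 0 < tol) {w : cl.TildeDof → ℝ} (hw : (U V tol)ᵀ *ᵥ (cl.B *ᵥ w) = 0) :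
    energy (Stilde cl A) ((cl.BD D)ᵀ *ᵥ (cl.B *ᵥ w))
      ≤ cl.boundConst * tol * energy (Stilde cl A) w := by
  have hcard : ∀ c : cl.Class, 2 ≤ (cl.I c).card := by
    rintro ⟨x⟩
    exact x.2.1
  set y := (cl.BD D)ᵀ *ᵥ (cl.B *ᵥ w) with hy
  have hy0 : ∀ v, y (.inr v) = 0 := BD_transpose_mulVec_inr cl D _
  set α : Fin N → cl.Class → ℝ := fun i c => energy (S A i) (piece y c i) with hα
  set β : Fin N → ℝ := fun i => energy (S A i) (Rtilde cl i *ᵥ w) with hβ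
  have hα0 : ∀ i c, 0 ≤ α i c := fun i c => energy_nonneg (posSemidef_S hA i) _
  have hβ0 : ∀ i, 0 ≤ β i := fun i => energy_nonneg (posSemidef_S hA i) _
  have hb : ∀ c : cl.Class, (((cl.I c).card - 1 : ℕ) : ℝ) = (cl.I c).card - 1 := fun c => by
    rw [Nat.cast_sub (by linarith [hcard c]), Nat.cast_one]
  have hclass : ∀ c, ∑ i ∈ cl.I c, α i c
      ≤ 2 * (((cl.I c).card - 1 : ℕ) : ℝ) * tol * ∑ i ∈ cl.I c, β i := fun c => by
    rw [hb]
    exact sum_energy_piece_le hA htol hw c (by linarith [hcard c])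
  -- The faces and the edges each contribute a quarter of the constant, `8 / 4` being the factor `2` in
  -- `2 (n - 1)`; their sum is doubled when the two parts of a subdomain are separated.
  have key : ∀ (G : Finset cl.Class), (∀ c ∈ G, ∀ i ∈ cl.I c, ∀ j ∈ cl.I c,
        8 * (((cl.I c).card - 1) * (G.filter (i ∈ cl.I ·)).card * (G.filter (j ∈ cl.I ·)).card)
          ≤ cl.boundConst) →
      ∑ i, ((G.filter (i ∈ cl.I ·)).card : ℝ) * ∑ c ∈ G.filter (i ∈ cl.I ·), α i c
        ≤ cl.boundConst / 4 * tol * ∑ i, β i := by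
    intro G hG
    refine sum_card_mul_sum_le cl.I G (b := fun c => 2 * (((cl.I c).card - 1 : ℕ) : ℝ)) hα0 hβ0
      htol.le (by positivity) (fun c hc i hi j hj => ?_)
      fun c _ => hclass c
    have := (Nat.cast_le (α := ℝ)).2 (hG c hc i hi j hj)
    push_cast [-Nat.cast_sub] at this
    linarith
  have hF : ∀ i, (Finset.univ.filter cl.IsFace).filter (i ∈ cl.I ·) = cl.faces i := fun i => by
    ext c; simp [mem_faces, and_comm]
  have hE : ∀ i, (Finset.univ.filter cl.IsEdge).filter (i ∈ cl.I ·) = cl.edges i := fun i => by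
    ext c; simp [mem_edges, and_comm]
  have h1 := key (Finset.univ.filter cl.IsFace) fun c hc i _ j _ => by
    rw [hF, hF]
    exact faces_mul_faces_le_boundConst cl (by simpa using hc) i j
  have h2 := key (Finset.univ.filter cl.IsEdge) fun c hc i hi j hj => by
    rw [hE, hE]
    exact edges_mul_edges_le_boundConst cl (by simpa using hc) hi hj
  simp only [hF] at h1
  simp only [hE] at h2
  have h3 : ∀ i, energy (S A i) (Rtilde cl i *ᵥ y)
      ≤ 2 * ((cl.faces i).card * ∑ c ∈ cl.faces i, α i c
        + (cl.edges i).card * ∑ c ∈ cl.edges i, α i c) := by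
    intro i
    rw [Rtilde_mulVec_eq_sum_piece y hy0]
    refine (energy_add_le (posSemidef_S hA i) _ _).trans ?_
    have := energy_sum_le (posSemidef_S hA i) (cl.faces i) fun c => piece y c i
    have := energy_sum_le (posSemidef_S hA i) (cl.edges i) fun c => piece y c i
    linarith
  rw [energy_Stilde, energy_Stilde]
  refine (Finset.sum_le_sum fun i _ => h3 i).trans ?_
  rw [← Finset.mul_sum, Finset.sum_add_distrib]
  linarith

/-- The nonzero eigenvalues of the preconditioned matrix lie between `1` and the bound. -/
theorem bounds_of_mem_eigenvalues (hA : ∀ i, (A i).PosSemidef) (hD : cl.IsPartitionOfUnity D)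
    (hS : StildeNonsingular cl A) {tol : ℝ} (htol : 0 < tol) {V : EigenChoice cl A D} {z : ℂ}
    (hz : z ∈ eigenvalues V tol) :
    z.im = 0 ∧ 0 ≤ z.re ∧ (z ≠ 0 → 1 ≤ z.re ∧ z.re ≤ (cl.boundConst : ℝ) * tol) := by
  rw [eigenvalues, preconditioned] at hz
  refine cspec_projector (posSemidef_Stilde hA) ?_ (B_BD_transpose_B_mulVec cl hD) (U V tol)
    (fun w hw => energy_BD_transpose_B_le hA htol hw) (P := P V tol) ?_ ?_ ?_ hz
  · rw [StildeNonsingular] at hS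
    exact hS
  · rw [FDP]
  · rw [P]
  · rw [MPPinv, MFETIinv]

theorem kappa_le (hA : ∀ i, (A i).PosSemidef) (hD : cl.IsPartitionOfUnity D)
    (hS : StildeNonsingular cl A) {tol : ℝ} (htol : 0 < tol) {V : EigenChoice cl A D} :
    kappa V tol ≤ (cl.boundConst : ℝ) * tol := by
  refine condNumber_le (by positivity) fun z hz hz0 => ?_
  obtain ⟨him, hre, h⟩ := bounds_of_mem_eigenvalues hA hD hS htol hz
  have hnorm : ‖z‖ = z.re := by
    rw [← Complex.re_add_im z, him]
    simp [abs_of_nonneg hre]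
  rw [hnorm]
  exact h hz0

end Bound

end

end FETIDP

theorem mainTheorem2 {d N : ℕ} (T : FETIDP.DecomposedMesh d N)
    (rho : EuclideanSpace ℝ (Fin d) → ℝ)
    (hint : MeasureTheory.IntegrableOn rho T.closedDomain)
    (hpos : ∃ r : ℝ, 0 < r ∧
      ∀ᵐ p ∂(MeasureTheory.volume.restrict T.closedDomain), r ≤ rho p)
    (cl : FETIDP.InterfaceClasses T.own)
    (D : cl.Scaling) (hD : cl.IsPartitionOfUnity D)
    (hS : FETIDP.StildeNonsingular cl (T.stiffness rho))
    (tol : ℝ) (htol : 0 < tol)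
    (V : FETIDP.EigenChoice cl (T.stiffness rho) D) :
    (∀ z ∈ FETIDP.eigenvalues V tol, z.im = 0 ∧ 0 ≤ z.re) ∧
    FETIDP.kappa V tol ≤ (cl.boundConst : ℝ) * tol := by
  obtain ⟨r, hr, hpos⟩ := hpos
  have hA : ∀ i, (T.stiffness rho i).PosSemidef :=
    T.posSemidef_stiffness (hpos.mono fun p hp => hr.le.trans hp)
  exact ⟨fun z hz => have h := FETIDP.bounds_of_mem_eigenvalues hA hD hS htol hz; ⟨h.1, h.2.1⟩,
    FETIDP.kappa_le hA hD hS htol⟩
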